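/- **Setting.** Let $G$ be a finite group with unit $1$; write $\bar g=g^{-1}$. The quantum double $\mathcal D(G)$ is the unital $*$-algebra with basis $(g,h)\in G\times G$, product $(g_1,h_1)(g_2,h_2)=\delta_{g_1,\,h_1g_2\bar h_1}(g_1,h_1h_2)$, unit $\sum_k (k,1)$ and $(g,h)^*=(\bar hgh,\bar h)$. An $n$-dimensional unitary representation is a unital $*$-homomorphism $D:\mathcal D(G)\to M_n(\mathbb C)$. Let $\Gamma$ be the triangular lattice in $\mathbb R^2$ with all edges oriented to the right. Let $\mathcal A$ be the quasi-local $C^*$-algebra with one copy of $\mathrm{End}(\mathbb C[G])$ for each edge, and $\mathcal A_X\subset\mathcal A$ the norm-closed subalgebra of observables supported on a set $X$ of edges. A subset of $\mathbb R^2$ is identified with the set of edges whose midpoints lie in it. A cone is a set $\{x:(x-a)\cdot\hat v>\|x-a\|\cos(\theta/2)\}$ with $a\in\mathbb R^2$, $\|\hat v\|=1$, $\theta\in(0,2\pi)$, or the same set with $\ge$. A site $s=(v,f)$ is a face $f$ with one of its corners $v$. The dual edge $e^*$ of an edge $e$ crosses $e$ from right to left. A direct triangle $\tau=(s_0,s_1,e)$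 consists of sites $s_0,s_1$ with the same face and the edge $e$ connecting their vertices; a dual triangle $\tau=(s_0,s_1,e)$ consists of sites $s_0,s_1$ with the same vertex and the edge $e$ whose dual edge connects their faces. Put $\partial_i\tau=s_i$ and $\bar\tau=(s_1,s_0,e)$. A direct triangle is positive if its face lies to the right of its edge oriented from $v(s_0)$ to $v(s_1)$; a dual triangle is positive if its vertex lies to the left of its dual edge oriented from $f(s_0)$ to $f(s_1)$; otherwise a triangle is negative. A (finite or half-infinite) ribbon is a (finite or infinite) sequence of triangles $\tau_1,\tau_2,\dots$ with $\partial_1\tau_i=\partial_0\tau_{i+1}$ in which no edge of $\Gamma$ occurs twice; it is positive (negative) if all its triangles are. The opposite of $\rho=\tau_1\cdots\tau_l$ is $\bar\rho=\bar\tau_l\cdots\bar\tau_1$. For half-infinite $\rho$, $\rho_m$ is the ribbon of its first $m$ triangles. On an edge $e$ let $L_e^h=\sum_g|hg\rangle\langle g|$, $R_e^h=\sum_g|g\bar h\rangle\langle g|$, $T_e^g=|g\rangle\langle g|$. For a direct triangle put $F_\tau^{h,g}=T_e^g$ if $e=(v(s_0),v(s_1))$ and $F_\tau^{h,g}=T_e^{\bar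 g}$ if $e=(v(s_1),v(s_0))$. For a dual triangle put $F_\tau^{h,g}=\delta_{g,1}L_\tau^h$, where, if $e^*=(f(s_0),f(s_1))$, $L_\tau^h=L_e^h$ when $v(s_0)$ is the origin of $e$ and $L^h_\tau=R_e^{\bar h}$ when it is the target of $e$; and if $e^*=(f(s_1),f(s_0))$, $L_\tau^h=L_e^{\bar h}$, respectively $R_e^{h}$. The empty ribbon has $F^{h,g}=\delta_{g,1}\mathbf 1$, and $F_{\rho_1\rho_2}^{h,g}=\sum_kF_{\rho_1}^{h,k}F_{\rho_2}^{\bar khk,\bar kg}$. Let $$\mathbf F_\rho^D=\sum_{g,h}F_\rho^{g,h}\otimes D(g,h)\in M_n(\mathcal A),\qquad \mu_\rho^D(O)=\mathbf F_\rho^D\,(O\otimes\mathbf 1_n)\,(\mathbf F_\rho^D)^*\quad(O\in\mathcal A)$$ for finite ribbons $\rho$, and $\mu_\rho^D(O)=\lim_{m\to\infty}\mu_{\rho_m}^D(O)$ (in norm) for half-infinite ribbons. Let $A_v=|G|^{-1}\sum_hF^{h,1}_{\rho}$ with $\rho$ the counterclockwise closed dual ribbon around the vertex $v$, and $B_f=F^{1,1}_{\rho}$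 with $\rho$ the counterclockwise closed direct ribbon around the face $f$. Let $\omega_0$ be the frustration-free ground state, i.e. the state on $\mathcal A$ with $\omega_0(A_v)=\omega_0(B_f)=1$ for all $v,f$; let $(\pi_0,\mathcal H_0,\Omega)$ be its GNS triple and $\mathcal R(\Lambda)=\pi_0(\mathcal A_\Lambda)''$. A bridge from a half-infinite ribbon $\rho$ to a half-infinite ribbon $\rho'$ is a sequence of finite ribbons $\xi_m$ ($m\ge1$) such that each concatenation $\sigma_m=\rho_m\,\xi_m\,\overline{\rho'_m}$ is a finite ribbon, and such that for every ball the $\xi_m$ are eventually supported outside of it; $\{\sigma_m\}$ is its intertwining sequence. **Lemma.** Let $\rho$ be a positive and $\rho'$ a negative half-infinite ribbon, both supported in a cone $\Lambda$, and suppose that there is a bridge from $\rho$ to $\rho'$ whose intertwining sequence $\{\sigma_m\}$ is supported in $\Lambda$. Let $D$ be an $n$-dimensional unitary representation of $\mathcal D(G)$. Then the limits defining $\mu_\rho^D$ and $\mu_{\rho'}^D$ exist, and there is a unitary $U\in M_n(\mathcal R(\Lambda))$ such that $$(\pi_0\otimes\mathrm{id})\circ\mu_{\rho'}^D=\mathrm{Ad}[U]\circ(\pi_0\otimes\mathrm{id})\circ\mu_\rho^D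 .$$ Moreover $U$ can be taken to be the limit of $(\pi_0\otimes\mathrm{id})(\mathbf F^D_{\overline{\sigma_m}})$ as $m\to\infty$ in the strong-$*$ operator topology. -/

import Mathlib

open scoped Matrix ComplexOrder InnerProductSpace
open Filter Topology

/-! ## The triangular lattice -/

/-- Vertices of the triangular lattice, in the lattice basis `(1, 0)`, `(1/2, √3/2)` of the plane. -/
abbrev Vertex : Type := ℤ × ℤ

/-- The edges of the triangular lattice. Every edge is oriented towards the right; in direction
`0` it points along `(1, 0)`, in direction `1` along `(1/2, √3/2)`, in direction `2` along
`(1/2, -√3/2)`. -/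
structure Edge where
  /-- the origin of the edge -/
  source : Vertex
  /-- the direction of the edge -/
  dir : Fin 3
deriving DecidableEq

/-- The end point of an edge. -/
def Edge.target (e : Edge) : Vertex :=
  ![(e.source.1 + 1, e.source.2), (e.source.1, e.source.2 + 1),
    (e.source.1 + 1, e.source.2 - 1)] e.dir

/-- The faces of the triangular lattice: `up a b` is the triangle pointing upwards with corners
`(a, b)`, `(a + 1, b)`, `(a, b + 1)`, and `down a b` is the triangle pointing downwards with
corners `(a + 1, b)`, `(a + 1, b + 1)`, `(a, b + 1)` (in lattice coordinates). -/
inductive Face where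
  | up (a b : ℤ)
  | down (a b : ℤ)
deriving DecidableEq

/-- The corners of a face. -/
def Face.corners : Face → Set Vertex
  | .up a b => {(a, b), (a + 1, b), (a, b + 1)}
  | .down a b => {(a + 1, b), (a + 1, b + 1), (a, b + 1)}

/-- The face to the left of an edge. -/
def Edge.left (e : Edge) : Face :=
  ![.up e.source.1 e.source.2, .down (e.source.1 - 1) e.source.2,
    .down e.source.1 (e.source.2 - 1)] e.dir

/-- The face to the right of an edge. -/
def Edge.right (e : Edge) : Face :=
  ![.down e.source.1 (e.source.2 - 1), .up e.source.1 e.source.2,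
    .up e.source.1 (e.source.2 - 1)] e.dir

/-- The Euclidean plane. -/
abbrev Plane : Type := EuclideanSpace ℝ (Fin 2)

/-- The position of a vertex in the plane. -/
noncomputable def Vertex.pos (v : Vertex) : Plane :=
  !₂[(v.1 : ℝ) + (v.2 : ℝ) / 2, √3 / 2 * (v.2 : ℝ)]

/-- The midpoint of an edge in the plane. -/
noncomputable def Edge.mid (e : Edge) : Plane :=
  midpoint ℝ (Vertex.pos e.source) (Vertex.pos e.target)

/-- The set of edges whose midpoints lie in a region of the plane. -/
def edgesIn (S : Set Plane) : Set Edge := {e | e.mid ∈ S}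

/-- Cones in the plane: the open cones with apex `a`, axis `v` (a unit vector) and opening angle
`θ ∈ (0, 2π)`, and their closed versions. This class of sets is closed under complements. -/
def IsCone (Λ : Set Plane) : Prop :=
  ∃ (a v : Plane) (θ : ℝ), ‖v‖ = 1 ∧ 0 < θ ∧ θ < 2 * Real.pi ∧
    (Λ = {x | ‖x - a‖ * Real.cos (θ / 2) < ⟪v, x - a⟫_ℝ} ∨
     Λ = {x | ‖x - a‖ * Real.cos (θ / 2) ≤ ⟪v, x - a⟫_ℝ})

/-! ## Sites, triangles and ribbons -/

/-- A site is a pair of a face and one of its corners. -/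
@[ext] structure Site where
  /-- the vertex of the site -/
  vertex : Vertex
  /-- the face of the site -/
  face : Face
  mem : vertex ∈ face.corners

/-- Direct and dual triangles `(s₀, s₁, e)`. In a direct triangle, the two sites share their face
and `e` connects their vertices. In a dual triangle, the two sites share their vertex and the dual
edge of `e`, which crosses `e` from right to left, connects their faces. -/
inductive Triangle where
  | direct (s₀ s₁ : Site) (e : Edge) (hface : s₀.face = s₁.face)
      (he : (s₀.vertex = e.source ∧ s₁.vertex = e.target) ∨
            (s₀.vertex = e.target ∧ s₁.vertex = e.source))
  | dual (s₀ s₁ : Site) (e : Edge) (hvertex : s₀.vertex = s₁.vertex)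
      (he : (s₀.face = e.right ∧ s₁.face = e.left) ∨ (s₀.face = e.left ∧ s₁.face = e.right))

namespace Triangle

/-- The initial site of a triangle. -/
def first : Triangle → Site
  | direct s₀ _ _ _ _ => s₀
  | dual s₀ _ _ _ _ => s₀

/-- The final site of a triangle. -/
def final : Triangle → Site
  | direct _ s₁ _ _ _ => s₁
  | dual _ s₁ _ _ _ => s₁

/-- The edge of a triangle. -/
def edge : Triangle → Edge
  | direct _ _ e _ _ => e
  | dual _ _ e _ _ => e

/-- The opposite triangle. -/
def opp : Triangle → Triangle
  | direct s₀ s₁ e hf he =>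
      direct s₁ s₀ e hf.symm (he.elim (fun h => Or.inr ⟨h.2, h.1⟩) (fun h => Or.inl ⟨h.2, h.1⟩))
  | dual s₀ s₁ e hv he =>
      dual s₁ s₀ e hv.symm (he.elim (fun h => Or.inr ⟨h.2, h.1⟩) (fun h => Or.inl ⟨h.2, h.1⟩))

/-- A direct triangle is positive if its face lies to the right of its edge, oriented from the
vertex of the initial site to that of the final site. A dual triangle is positive if its vertex
lies to the left of its dual edge, oriented from the face of the initial site to that of the final
site (the origin of `e` lies to the left of the dual edge crossing `e` from right to left). -/
def IsPositive : Triangle → Prop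
  | direct s₀ s₁ e _ _ =>
      (s₀.vertex = e.source ∧ s₁.vertex = e.target ∧ s₀.face = e.right) ∨
      (s₀.vertex = e.target ∧ s₁.vertex = e.source ∧ s₀.face = e.left)
  | dual s₀ s₁ e _ _ =>
      (s₀.face = e.right ∧ s₁.face = e.left ∧ s₀.vertex = e.source) ∨
      (s₀.face = e.left ∧ s₁.face = e.right ∧ s₀.vertex = e.target)

end Triangle

/-- A list of triangles is a (finite) ribbon if consecutive triangles fit together and no edge
belongs to more than one of the triangles. -/
def IsRibbon (ρ : List Triangle) : Prop :=
  ρ.IsChain (fun τ τ' => τ.final = τ'.first) ∧ (ρ.map Triangle.edge).Nodup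

/-- The opposite ribbon. -/
def oppRibbon (ρ : List Triangle) : List Triangle := (ρ.map Triangle.opp).reverse

/-- A finite ribbon is supported in a region if the midpoints of all its edges lie there. -/
def RibbonIn (ρ : List Triangle) (S : Set Plane) : Prop := ∀ τ ∈ ρ, τ.edge ∈ edgesIn S

/-- A half-infinite ribbon. The triangles are numbered from `0` here. -/
structure HalfInfiniteRibbon where
  /-- the sequence of triangles -/
  tri : ℕ → Triangle
  chain : ∀ k, (tri k).final = (tri (k + 1)).first
  edge_injective : Function.Injective fun k => (tri k).edge

namespace HalfInfiniteRibbon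

/-- The finite ribbon consisting of the first `m` triangles of `ρ`. -/
def initial (ρ : HalfInfiniteRibbon) (m : ℕ) : List Triangle := (List.range m).map ρ.tri

/-- Positive half-infinite ribbons. -/
def IsPositive (ρ : HalfInfiniteRibbon) : Prop := ∀ k, (ρ.tri k).IsPositive

/-- Negative half-infinite ribbons. -/
def IsNegative (ρ : HalfInfiniteRibbon) : Prop := ∀ k, ¬ (ρ.tri k).IsPositive

/-- A half-infinite ribbon is supported in a region if the midpoints of all its edges lie there. -/
def SupportedIn (ρ : HalfInfiniteRibbon) (S : Set Plane) : Prop :=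
  ∀ k, (ρ.tri k).edge ∈ edgesIn S

end HalfInfiniteRibbon

/-- The concatenation `σ_m` of `ρ_m`, `ξ_m` and the opposite of `ρ'_m`. -/
def intertwiningRibbon (ρ ρ' : HalfInfiniteRibbon) (ξ : ℕ → List Triangle) (m : ℕ) :
    List Triangle :=
  ρ.initial m ++ ξ m ++ oppRibbon (ρ'.initial m)

/-- `ξ_1, ξ_2, …` is a bridge from `ρ` to `ρ'` (the value `ξ 0` plays no role). -/
structure IsBridge (ρ ρ' : HalfInfiniteRibbon) (ξ : ℕ → List Triangle) : Prop where
  ribbon : ∀ m, 1 ≤ m → IsRibbon (ξ m)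
  concat : ∀ m, 1 ≤ m → IsRibbon (intertwiningRibbon ρ ρ' ξ m)
  escapes : ∀ (x : Plane) (r : ℝ), ∀ᶠ m in atTop, RibbonIn (ξ m) (Metric.ball x r)ᶜ

/-! ## The quantum double algebra of a finite group -/

/-- The quantum double algebra `𝒟(G)`: the element `a` stands for the formal linear combination
`∑ a(g, h) (g, h)`. -/
structure QuantumDouble (G : Type*) where
  /-- the coefficients -/
  coeff : G → G → ℂ

namespace QuantumDouble

variable {G : Type*}

@[ext] theorem ext {a b : QuantumDouble G} (h : ∀ x y, a.coeff x y = b.coeff x y) : a = b := by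
  cases a; cases b; congr; funext x y; exact h x y

instance : Zero (QuantumDouble G) := ⟨⟨fun _ _ => 0⟩⟩
instance : Add (QuantumDouble G) := ⟨fun a b => ⟨fun x y => a.coeff x y + b.coeff x y⟩⟩
instance : Neg (QuantumDouble G) := ⟨fun a => ⟨fun x y => -a.coeff x y⟩⟩
instance : SMul ℂ (QuantumDouble G) := ⟨fun c a => ⟨fun x y => c * a.coeff x y⟩⟩

/-- The basis element `(g, h)`. -/
def of [DecidableEq G] (g h : G) : QuantumDouble G := ⟨fun x y => if x = g ∧ y = h then 1 else 0⟩

variable [Group G] [Fintype G] [DecidableEq G]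

/-- The bilinear extension of `(g₁, h₁) (g₂, h₂) = δ_{g₁, h₁ g₂ h₁⁻¹} (g₁, h₁ h₂)`. -/
instance : Mul (QuantumDouble G) :=
  ⟨fun a b => ⟨fun g h => ∑ k, a.coeff g k * b.coeff (k⁻¹ * g * k) (k⁻¹ * h)⟩⟩

/-- The unit `∑ₖ (k, 1)`. -/
instance : One (QuantumDouble G) := ⟨⟨fun _ h => if h = 1 then 1 else 0⟩⟩

/-- The antilinear extension of `(g, h)* = (h⁻¹ g h, h⁻¹)`. -/
instance : Star (QuantumDouble G) := ⟨fun a => ⟨fun g h => star (a.coeff (h⁻¹ * g * h) h⁻¹)⟩⟩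

@[simp] theorem coeff_zero (g h : G) : (0 : QuantumDouble G).coeff g h = 0 := rfl
@[simp] theorem coeff_add (a b : QuantumDouble G) (g h : G) :
    (a + b).coeff g h = a.coeff g h + b.coeff g h := rfl
@[simp] theorem coeff_neg (a : QuantumDouble G) (g h : G) : (-a).coeff g h = -a.coeff g h := rfl
@[simp] theorem coeff_smul (c : ℂ) (a : QuantumDouble G) (g h : G) :
    (c • a).coeff g h = c * a.coeff g h := rfl
theorem coeff_mul (a b : QuantumDouble G) (g h : G) :
    (a * b).coeff g h = ∑ k, a.coeff g k * b.coeff (k⁻¹ * g * k) (k⁻¹ * h) := rfl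
theorem coeff_one (g h : G) : (1 : QuantumDouble G).coeff g h = if h = 1 then 1 else 0 := rfl
@[simp] theorem coeff_star (a : QuantumDouble G) (g h : G) :
    (star a).coeff g h = star (a.coeff (h⁻¹ * g * h) h⁻¹) := rfl
theorem coeff_of (g h x y : G) : (of g h).coeff x y = if x = g ∧ y = h then 1 else 0 := rfl

protected theorem mul_assoc (a b c : QuantumDouble G) : a * b * c = a * (b * c) := by
  ext g h
  simp only [coeff_mul, Finset.sum_mul, Finset.mul_sum]
  rw [Finset.sum_comm]
  refine Finset.sum_congr rfl fun k _ => ?_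
  refine (Fintype.sum_equiv (Equiv.mulLeft k) _ _ fun l => ?_).symm
  simp [mul_assoc]

protected theorem one_mul (a : QuantumDouble G) : 1 * a = a := by
  ext g h; simp [coeff_mul, coeff_one]

protected theorem mul_one (a : QuantumDouble G) : a * 1 = a := by
  ext g h; simp [coeff_mul, coeff_one, inv_mul_eq_one]

instance : Ring (QuantumDouble G) where
  add_assoc a b c := by ext; simp [add_assoc]
  zero_add a := by ext; simp
  add_zero a := by ext; simp
  add_comm a b := by ext; simp [add_comm]
  neg_add_cancel a := by ext; simp
  nsmul := nsmulRec
  zsmul := zsmulRec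
  mul_assoc := QuantumDouble.mul_assoc
  one_mul := QuantumDouble.one_mul
  mul_one := QuantumDouble.mul_one
  left_distrib a b c := by ext; simp [coeff_mul, mul_add, Finset.sum_add_distrib]
  right_distrib a b c := by ext; simp [coeff_mul, add_mul, Finset.sum_add_distrib]
  zero_mul a := by ext; simp [coeff_mul]
  mul_zero a := by ext; simp [coeff_mul]

instance : Module ℂ (QuantumDouble G) where
  one_smul a := by ext; simp
  mul_smul c d a := by ext; simp [mul_assoc]
  smul_zero c := by ext; simp
  smul_add c a b := by ext; simp [mul_add]
  add_smul c d a := by ext; simp [add_mul]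
  zero_smul a := by ext; simp

instance : Algebra ℂ (QuantumDouble G) :=
  Algebra.ofModule
    (fun c a b => by ext; simp [coeff_mul, Finset.mul_sum, mul_assoc])
    (fun c a b => by ext; simp [coeff_mul, Finset.mul_sum, mul_left_comm])

instance : StarRing (QuantumDouble G) where
  star_involutive a := by ext; simp [mul_assoc]
  star_mul a b := by
    ext g h
    simp only [coeff_mul, coeff_star, star_sum, star_mul']
    refine Fintype.sum_equiv (Equiv.mulLeft h) _ _ fun k => ?_
    simp [mul_assoc, mul_comm]
  star_add a b := by ext; simp

theorem of_mul_of (g₁ h₁ g₂ h₂ : G) :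
    of g₁ h₁ * of g₂ h₂ = if g₁ = h₁ * g₂ * h₁⁻¹ then of g₁ (h₁ * h₂) else 0 := by
  ext x y
  rw [coeff_mul, Finset.sum_eq_single h₁]
  · by_cases hx : x = g₁
    · subst hx
      by_cases hg : x = h₁ * g₂ * h₁⁻¹
      · simp [coeff_of, hg, mul_assoc, inv_mul_eq_iff_eq_mul]
      · have : ¬ h₁⁻¹ * x * h₁ = g₂ := fun h => hg (by rw [← h]; group)
        simp [coeff_of, hg, this]
    · split_ifs <;> simp [coeff_of, hx]
  · intro b _ hb; simp [coeff_of, hb]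
  · simp

theorem star_of (g h : G) : star (of g h) = of (h⁻¹ * g * h) h⁻¹ := by
  ext x y
  simp only [coeff_star, coeff_of]
  by_cases hy : y = h⁻¹
  · subst hy
    have : (h * x * h⁻¹ = g) ↔ (x = h⁻¹ * g * h) := by
      constructor
      · rintro rfl; group
      · rintro rfl; group
    simp [this, apply_ite star]
  · have : ¬ y⁻¹ = h := fun h' => hy (by rw [← h', inv_inv])
    simp [hy, this]

end QuantumDouble

/-! ## The quasi-local algebra

It is realised on the Hilbert space spanned by the configurations of group elements on the edges
which are trivial away from finitely many edges (the infinite tensor product of the `ℂ[G]` along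
the reference vectors `|1⟩`). -/

/-- Configurations of group elements that are trivial on all but finitely many edges. -/
abbrev Config (G : Type*) [Group G] : Type _ := {c : Edge → G // {e | c e ≠ 1}.Finite}

/-- The configuration that agrees with `c` away from `e` and takes the value `g` on `e`. -/
def Config.set {G : Type*} [Group G] (c : Config G) (e : Edge) (g : G) : Config G :=
  ⟨Function.update c.1 e g, (c.2.insert e).subset fun e' he' => by
    by_cases h : e' = e
    · exact Or.inl h
    · exact Or.inr (by simpa [Function.update_of_ne h] using he')⟩

/-- The Hilbert space with orthonormal basis the configurations. -/
abbrev RefSpace (G : Type*) [Group G] : Type _ := lp (fun _ : Config G => ℂ) 2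

section MatrixUnits

variable {G : Type*} [Group G] [DecidableEq G]

theorem Config.set_injOn (e : Edge) (g h : G) :
    Set.InjOn (fun c : Config G => c.set e h) {c | c.1 e = g} := by
  intro c hc c' hc' heq
  apply Subtype.ext
  funext e'
  by_cases he : e' = e
  · subst he; exact hc.trans hc'.symm
  · have := congrFun (congrArg Subtype.val heq) e'
    simpa [Config.set, Function.update_of_ne he] using this

/-- The function underlying the action of `|g⟩⟨h|` on the edge `e`. -/
def matUnitFun (e : Edge) (g h : G) (ψ : Config G → ℂ) (c : Config G) : ℂ :=
  if c.1 e = g then ψ (c.set e h) else 0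

theorem matUnit_sum_le (e : Edge) (g h : G) (ψ : RefSpace G) (s : Finset (Config G)) :
    ∑ c ∈ s, ‖matUnitFun e g h ψ c‖ ^ (2 : ENNReal).toReal ≤ ‖ψ‖ ^ (2 : ENNReal).toReal := by
  classical
  have h2 : (0 : ℝ) < (2 : ENNReal).toReal := by simp
  have hinj : Set.InjOn (fun c : Config G => c.set e h) (s.filter fun c => c.1 e = g) := by
    intro c hc c' hc' heq
    simp only [Finset.coe_filter, Set.mem_ofPred_eq] at hc hc'
    exact Config.set_injOn e g h hc.2 hc'.2 heq
  have : ∑ c ∈ s, ‖matUnitFun e g h ψ c‖ ^ (2 : ENNReal).toReal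
      = ∑ c ∈ (s.filter fun c => c.1 e = g).image (fun c : Config G => c.set e h),
          ‖ψ c‖ ^ (2 : ENNReal).toReal := by
    rw [Finset.sum_image hinj, Finset.sum_filter]
    refine Finset.sum_congr rfl fun c _ => ?_
    unfold matUnitFun
    split_ifs <;> simp
  rw [this]
  exact lp.sum_rpow_le_norm_rpow h2 ψ _

/-- The operator `|g⟩⟨h|` on the edge `e`. -/
noncomputable def matUnitOp (e : Edge) (g h : G) : RefSpace G →L[ℂ] RefSpace G :=
  LinearMap.mkContinuous
    { toFun := fun ψ => ⟨matUnitFun e g h ψ, memℓp_gen' (matUnit_sum_le e g h ψ)⟩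
      map_add' := fun ψ φ => by
        ext c
        simp only [lp.coeFn_add, Pi.add_apply, matUnitFun]
        split_ifs <;> simp
      map_smul' := fun z ψ => by
        ext c
        simp only [lp.coeFn_smul, Pi.smul_apply, matUnitFun, RingHom.id_apply]
        split_ifs <;> simp }
    1
    (fun ψ => by
      rw [one_mul]
      exact lp.norm_le_of_forall_sum_le (by simp) (norm_nonneg _) (matUnit_sum_le e g h ψ))

variable (G) in
/-- The algebra of observables supported on the set `X` of edges: the norm closure of the
`*`-algebra generated by the matrix algebras of the edges in `X`. -/
noncomputable def localAlgebra (X : Set Edge) :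
    StarSubalgebra ℂ (RefSpace G →L[ℂ] RefSpace G) :=
  (StarAlgebra.adjoin ℂ {T | ∃ e ∈ X, ∃ g h : G, T = matUnitOp e g h}).topologicalClosure

variable (G) in
/-- The quasi-local algebra `𝒜`. -/
noncomputable abbrev quasiLocal : StarSubalgebra ℂ (RefSpace G →L[ℂ] RefSpace G) :=
  localAlgebra G Set.univ

/-- The matrix unit `|g⟩⟨h|` of the edge `e`, as an element of `𝒜`. -/
noncomputable def matUnit (e : Edge) (g h : G) : quasiLocal G :=
  ⟨matUnitOp e g h, StarSubalgebra.le_topologicalClosure _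
    (StarAlgebra.subset_adjoin ℂ _ ⟨e, Set.mem_univ e, g, h, rfl⟩)⟩

end MatrixUnits

section Ribbons

variable {G : Type*} [Group G] [Fintype G] [DecidableEq G]

/-! ## Ribbon operators -/

/-- `L_e^h = ∑_g |hg⟩⟨g|`. -/
noncomputable def edgeL (e : Edge) (h : G) : quasiLocal G := ∑ g, matUnit e (h * g) g

/-- `R_e^h = ∑_g |g h⁻¹⟩⟨g|`. -/
noncomputable def edgeR (e : Edge) (h : G) : quasiLocal G := ∑ g, matUnit e (g * h⁻¹) g

/-- `T_e^g = |g⟩⟨g|`. -/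
noncomputable def edgeT (e : Edge) (g : G) : quasiLocal G := matUnit e g g

/-- The ribbon operators `F_τ^{h,g}` of a single triangle: `T_τ^g` for a direct triangle and
`δ_{g,1} L_τ^h` for a dual triangle. -/
noncomputable def triangleOp (τ : Triangle) (h g : G) : quasiLocal G :=
  match τ with
  | .direct s₀ _ e _ _ => if s₀.vertex = e.source then edgeT e g else edgeT e g⁻¹
  | .dual s₀ _ e _ _ =>
      if g = 1 then
        if s₀.face = e.right then
          if s₀.vertex = e.source then edgeL e h else edgeR e h⁻¹
        else
          if s₀.vertex = e.source then edgeL e h⁻¹ else edgeR e h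
      else 0

/-- The ribbon operators `F_ρ^{h,g}`. -/
noncomputable def ribbonOp : List Triangle → G → G → quasiLocal G
  | [], _, g => if g = 1 then 1 else 0
  | τ :: ρ, h, g => ∑ k, triangleOp τ h k * ribbonOp ρ (k⁻¹ * h * k) (k⁻¹ * g)

/-- The ribbon multiplet `𝐅_ρ^D = ∑_{g,h} F_ρ^{g,h} ⊗ D(g, h)`, a matrix over `𝒜`. -/
noncomputable def ribbonMultiplet {n : ℕ}
    (D : QuantumDouble G →⋆ₐ[ℂ] Matrix (Fin n) (Fin n) ℂ) (ρ : List Triangle) :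
    Matrix (Fin n) (Fin n) (quasiLocal G) :=
  Matrix.of fun i j => ∑ g, ∑ h, D (QuantumDouble.of g h) i j • ribbonOp ρ g h

/-- `μ_ρ^D(O) = 𝐅_ρ^D (O ⊗ 1) (𝐅_ρ^D)*` for a finite ribbon `ρ`. -/
noncomputable def finiteAmpli {n : ℕ}
    (D : QuantumDouble G →⋆ₐ[ℂ] Matrix (Fin n) (Fin n) ℂ) (ρ : List Triangle)
    (O : quasiLocal G) : Matrix (Fin n) (Fin n) (quasiLocal G) :=
  ribbonMultiplet D ρ * Matrix.diagonal (fun _ => O) * (ribbonMultiplet D ρ)ᴴ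

/-- `μ_ρ^D(O) = lim_m μ_{ρ_m}^D(O)` for a half-infinite ribbon `ρ`. -/
noncomputable def ampli {n : ℕ}
    (D : QuantumDouble G →⋆ₐ[ℂ] Matrix (Fin n) (Fin n) ℂ) (ρ : HalfInfiniteRibbon)
    (O : quasiLocal G) : Matrix (Fin n) (Fin n) (quasiLocal G) :=
  limUnder atTop fun m => finiteAmpli D (ρ.initial m) O

/-! ## The ground state and the cone algebras -/

/-- The counterclockwise closed dual ribbon around the vertex `(a, b)`, starting at the site with
face `up a b`. -/
def starRibbon (a b : ℤ) : List Triangle :=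
  let s₀ : Site := ⟨(a, b), .up a b, by simp [Face.corners]⟩
  let s₁ : Site := ⟨(a, b), .down (a - 1) b, by simp [Face.corners]⟩
  let s₂ : Site := ⟨(a, b), .up (a - 1) b, by simp [Face.corners]⟩
  let s₃ : Site := ⟨(a, b), .down (a - 1) (b - 1), by simp [Face.corners]⟩
  let s₄ : Site := ⟨(a, b), .up a (b - 1), by simp [Face.corners]⟩
  let s₅ : Site := ⟨(a, b), .down a (b - 1), by simp [Face.corners]⟩
  [.dual s₀ s₁ ⟨(a, b), 1⟩ rfl (by simp [s₀, s₁, Edge.left, Edge.right]),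
   .dual s₁ s₂ ⟨(a - 1, b + 1), 2⟩ rfl (by simp [s₁, s₂, Edge.left, Edge.right]),
   .dual s₂ s₃ ⟨(a - 1, b), 0⟩ rfl (by simp [s₂, s₃, Edge.left, Edge.right]),
   .dual s₃ s₄ ⟨(a, b - 1), 1⟩ rfl (by simp [s₃, s₄, Edge.left, Edge.right]),
   .dual s₄ s₅ ⟨(a, b), 2⟩ rfl (by simp [s₄, s₅, Edge.left, Edge.right]),
   .dual s₅ s₀ ⟨(a, b), 0⟩ rfl (by simp [s₅, s₀, Edge.left, Edge.right])]

/-- The counterclockwise closed direct ribbon around a face. -/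
def plaquetteRibbon : Face → List Triangle
  | .up a b =>
    let s₀ : Site := ⟨(a, b), .up a b, by simp [Face.corners]⟩
    let s₁ : Site := ⟨(a + 1, b), .up a b, by simp [Face.corners]⟩
    let s₂ : Site := ⟨(a, b + 1), .up a b, by simp [Face.corners]⟩
    [.direct s₀ s₁ ⟨(a, b), 0⟩ rfl (by simp [s₀, s₁, Edge.target]),
     .direct s₁ s₂ ⟨(a, b + 1), 2⟩ rfl (by simp [s₁, s₂, Edge.target]),
     .direct s₂ s₀ ⟨(a, b), 1⟩ rfl (by simp [s₂, s₀, Edge.target])]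
  | .down a b =>
    let s₀ : Site := ⟨(a + 1, b), .down a b, by simp [Face.corners]⟩
    let s₁ : Site := ⟨(a + 1, b + 1), .down a b, by simp [Face.corners]⟩
    let s₂ : Site := ⟨(a, b + 1), .down a b, by simp [Face.corners]⟩
    [.direct s₀ s₁ ⟨(a + 1, b), 1⟩ rfl (by simp [s₀, s₁, Edge.target]),
     .direct s₁ s₂ ⟨(a, b + 1), 0⟩ rfl (by simp [s₁, s₂, Edge.target]),
     .direct s₂ s₀ ⟨(a, b + 1), 2⟩ rfl (by simp [s₂, s₀, Edge.target])]

variable (G) in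
/-- The star operator `A_v = |G|⁻¹ ∑_h A_v^h`. -/
noncomputable def starOp (v : Vertex) : quasiLocal G :=
  (Fintype.card G : ℂ)⁻¹ • ∑ h : G, ribbonOp (starRibbon v.1 v.2) h 1

variable (G) in
/-- The plaquette operator `B_f`, the projection onto trivial flux at `f`. -/
noncomputable def plaquetteOp (f : Face) : quasiLocal G :=
  ribbonOp (plaquetteRibbon f) 1 1

/-- `ω` is a state on `𝒜` with `ω(A_v) = ω(B_f) = 1` for all vertices `v` and faces `f`. -/
structure IsFrustrationFreeGroundState (ω : quasiLocal G →ₗ[ℂ] ℂ) : Prop where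
  nonneg : ∀ a, 0 ≤ ω (star a * a)
  map_one : ω 1 = 1
  star_eq_one : ∀ v, ω (starOp G v) = 1
  plaquette_eq_one : ∀ f, ω (plaquetteOp G f) = 1

variable {H : Type*} [NormedAddCommGroup H] [InnerProductSpace ℂ H] [CompleteSpace H]

/-- `(π, H, Ω)` is a GNS triple of the functional `ω`: a cyclic representation with cyclic vector
`Ω` such that `ω(a) = ⟪Ω, π(a) Ω⟫`. It is unique up to unitary equivalence. -/
structure IsGNSTriple (ω : quasiLocal G →ₗ[ℂ] ℂ) (π : quasiLocal G →⋆ₐ[ℂ] (H →L[ℂ] H)) (Ω : H) :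
    Prop where
  vector_state : ∀ a, ω a = ⟪Ω, π a Ω⟫_ℂ
  cyclic : Dense (Set.range fun a => π a Ω)

/-- The cone algebra `ℛ(Λ) = π(𝒜_Λ)''`. -/
def coneAlgebra (π : quasiLocal G →⋆ₐ[ℂ] (H →L[ℂ] H)) (Λ : Set Plane) : Set (H →L[ℂ] H) :=
  Set.centralizer (Set.centralizer
    (π '' {a | (a : RefSpace G →L[ℂ] RefSpace G) ∈ localAlgebra G (edgesIn Λ)}))

end Ribbons

/-!
The multiplets `F_ρ^D` are unitary and multiplicative under concatenation, and `ρ ↦ ρ̄` turns them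
into their adjoints. Far multiplets commute with a local observable, so `μ_{ρ_m}^D` is eventually
constant on the dense local algebra and converges everywhere by contractivity. The same splitting
`σ_m = ρ_K · (middle part) · ρ̄'_K` reduces strong convergence of `π₀(F_{σ_m}^D)` on `π₀(local) Ω`
to the action of the middle parts on `Ω` alone.

On flat configurations, the only ones seen by `Ω`, the holonomy of a ribbon is a difference of
potentials at its ends, and two ribbons with the same end sites translate the configuration in ways
that differ by a gauge transformation supported where the closed path they form winds. So the two
ribbon operators agree on `Ω` once the winding function vanishes at the end vertices. A cone leaves
a region extending to infinity which the middle parts avoid, and this forces that vanishing.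
Reversing all ribbons gives convergence of the adjoints.
-/

/-! ## Observables on configurations -/

section Configurations

variable {G : Type*} [Group G]

namespace Config

@[simp] theorem set_apply (c : Config G) (e : Edge) (g : G) (e' : Edge) :
    (c.set e g).1 e' = if e' = e then g else c.1 e' :=
  Function.update_apply _ _ _ _

theorem ext {c c' : Config G} (h : ∀ e, c.1 e = c'.1 e) : c = c' :=
  Subtype.ext (funext h)

@[simp] theorem set_set (c : Config G) (e : Edge) (g h : G) : (c.set e g).set e h = c.set e h :=
  Subtype.ext (Function.update_idem _ _ _)

@[simp] theorem set_self (c : Config G) (e : Edge) : c.set e (c.1 e) = c :=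
  Subtype.ext (Function.update_eq_self _ _)

theorem set_comm (c : Config G) {e e' : Edge} (he : e ≠ e') (g g' : G) :
    (c.set e g).set e' g' = (c.set e' g').set e g :=
  Subtype.ext (Function.update_comm he _ _ _)

end Config

open Classical in
/-- The basis vector `|c⟩` of a configuration `c`. -/
noncomputable def ket (c : Config G) : RefSpace G := lp.single 2 c (1 : ℂ)

open Classical in
theorem ket_apply (c c' : Config G) : (ket c : Config G → ℂ) c' = if c' = c then 1 else 0 := by
  rw [ket, lp.single_apply]
  by_cases h : c' = c
  · subst h; simp
  · simp [h]

theorem inner_ket_left (c : Config G) (ψ : RefSpace G) : ⟪ket c, ψ⟫_ℂ = ψ c := by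
  classical
  rw [ket, lp.inner_single_left]; simp

theorem continuousLinearMap_ext_ket {F : Type*} [NormedAddCommGroup F] [NormedSpace ℂ F]
    {S T : RefSpace G →L[ℂ] F} (h : ∀ c, S (ket c) = T (ket c)) : S = T := by
  classical
  ext ψ
  have hψ : HasSum (fun c => ψ c • ket c) ψ := by
    convert lp.hasSum_single ENNReal.ofNat_ne_top ψ using 2 with c
    rw [ket, ← lp.single_smul, smul_eq_mul, mul_one]
  refine (S.hasSum hψ).unique ?_
  simpa only [map_smul, h] using T.hasSum hψ

theorem star_eq_of_inner_ket {S T : RefSpace G →L[ℂ] RefSpace G}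
    (h : ∀ c c', ⟪S (ket c), ket c'⟫_ℂ = ⟪ket c, T (ket c')⟫_ℂ) : star S = T := by
  refine continuousLinearMap_ext_ket fun c' => ?_
  ext c
  rw [← inner_ket_left, ← inner_ket_left, ContinuousLinearMap.star_eq_adjoint,
    ContinuousLinearMap.adjoint_inner_right, h]

variable [DecidableEq G]

theorem matUnitOp_apply (e : Edge) (g h : G) (ψ : RefSpace G) (c : Config G) :
    (matUnitOp e g h ψ : Config G → ℂ) c = if c.1 e = g then ψ (c.set e h) else 0 := rfl

theorem matUnitOp_ket (e : Edge) (g h : G) (c : Config G) :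
    matUnitOp e g h (ket c) = if c.1 e = h then ket (c.set e g) else 0 := by
  classical
  ext c'
  have set_eq_iff : (c'.1 e = g ∧ c'.set e h = c) ↔ (c.1 e = h ∧ c' = c.set e g) := by
    constructor <;> rintro ⟨rfl, rfl⟩ <;> simp
  rw [matUnitOp_apply, ket_apply, ← ite_and, if_congr set_eq_iff rfl rfl]
  by_cases hc : c.1 e = h
  · simp [hc, ket_apply]
  · simp [hc]

theorem star_matUnitOp (e : Edge) (g h : G) : star (matUnitOp e g h) = matUnitOp e h g := by
  classical
  refine star_eq_of_inner_ket fun c c' => ?_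
  rw [inner_ket_left, matUnitOp_apply, matUnitOp_ket]
  split_ifs
  · rw [inner_ket_left, ket_apply]
  · exact inner_zero_left _

/-- The action of an observable on the reference Hilbert space. -/
noncomputable def actOn (a : quasiLocal G) (ψ : RefSpace G) : RefSpace G :=
  (a : RefSpace G →L[ℂ] RefSpace G) ψ

theorem quasiLocal_ext_ket {a b : quasiLocal G} (h : ∀ c, actOn a (ket c) = actOn b (ket c)) :
    a = b :=
  Subtype.ext (continuousLinearMap_ext_ket h)

@[simp] theorem actOn_mul (a b : quasiLocal G) (ψ : RefSpace G) :
    actOn (a * b) ψ = actOn a (actOn b ψ) := rfl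

@[simp] theorem actOn_one (ψ : RefSpace G) : actOn (1 : quasiLocal G) ψ = ψ := rfl

@[simp] theorem actOn_zero (ψ : RefSpace G) : actOn (0 : quasiLocal G) ψ = 0 := rfl

@[simp] theorem actOn_vec_zero (a : quasiLocal G) : actOn a 0 = 0 := map_zero _

theorem actOn_vec_sum {ι : Type*} (s : Finset ι) (a : quasiLocal G) (ψ : ι → RefSpace G) :
    actOn a (∑ i ∈ s, ψ i) = ∑ i ∈ s, actOn a (ψ i) := map_sum _ _ _

theorem actOn_sum {ι : Type*} (s : Finset ι) (a : ι → quasiLocal G) (ψ : RefSpace G) :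
    actOn (∑ i ∈ s, a i) ψ = ∑ i ∈ s, actOn (a i) ψ := by
  simp only [actOn, AddSubmonoidClass.coe_finsetSum, sum_apply]

theorem actOn_matUnit_ket (e : Edge) (g h : G) (c : Config G) :
    actOn (matUnit e g h) (ket c) = if c.1 e = h then ket (c.set e g) else 0 :=
  matUnitOp_ket e g h c

@[simp] theorem star_matUnit (e : Edge) (g h : G) : star (matUnit e g h) = matUnit e h g :=
  Subtype.ext (star_matUnitOp e g h)

theorem matUnit_mul_matUnit (e : Edge) (g h g' h' : G) :
    matUnit e g h * matUnit e g' h' = if h = g' then matUnit e g h' else 0 := by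
  refine quasiLocal_ext_ket fun c => ?_
  rw [actOn_mul, actOn_matUnit_ket]
  by_cases hc : c.1 e = h' <;> by_cases hg : h = g' <;>
    simp [hc, hg, eq_comm, actOn_matUnit_ket]

theorem commute_matUnit {e e' : Edge} (he : e ≠ e') (g h g' h' : G) :
    Commute (matUnit e g h) (matUnit e' g' h') := by
  refine quasiLocal_ext_ket fun c => ?_
  rw [actOn_mul, actOn_mul, actOn_matUnit_ket, actOn_matUnit_ket]
  by_cases hc : c.1 e = h <;> by_cases hc' : c.1 e' = h' <;>
    simp [hc, hc', actOn_matUnit_ket, he, he.symm, Config.set_comm]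

theorem actOn_edgeT_ket (e : Edge) (g : G) (c : Config G) :
    actOn (edgeT e g) (ket c) = if c.1 e = g then ket c else 0 := by
  rw [edgeT, actOn_matUnit_ket]
  split_ifs with h
  · rw [← h, Config.set_self]
  · rfl

theorem edgeT_mul (e : Edge) (g h : G) :
    edgeT e g * edgeT e h = if g = h then edgeT e g else 0 := by
  rw [edgeT, edgeT, matUnit_mul_matUnit]
  split_ifs with hg
  · rw [hg]
  · rfl

theorem star_edgeT (e : Edge) (h : G) : star (edgeT e h) = edgeT e h := star_matUnit e h h

variable [Fintype G]

theorem sum_matUnit (e : Edge) : ∑ g : G, matUnit e g g = 1 := by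
  refine quasiLocal_ext_ket fun c => ?_
  simp only [actOn_sum, actOn_matUnit_ket, Finset.sum_ite_eq, Finset.mem_univ, if_true,
    Config.set_self, actOn_one]

theorem sum_edgeT (e : Edge) : ∑ g : G, edgeT e g = 1 := sum_matUnit e

theorem actOn_edgeL_ket (e : Edge) (h : G) (c : Config G) :
    actOn (edgeL e h) (ket c) = ket (c.set e (h * c.1 e)) := by
  simp [edgeL, actOn_sum, actOn_matUnit_ket]

theorem actOn_edgeR_ket (e : Edge) (h : G) (c : Config G) :
    actOn (edgeR e h) (ket c) = ket (c.set e (c.1 e * h⁻¹)) := by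
  simp [edgeR, actOn_sum, actOn_matUnit_ket]

theorem edgeL_mul (e : Edge) (g h : G) : edgeL e g * edgeL e h = edgeL e (g * h) :=
  quasiLocal_ext_ket fun c => by simp [actOn_edgeL_ket, mul_assoc]

theorem edgeR_mul (e : Edge) (g h : G) : edgeR e g * edgeR e h = edgeR e (g * h) :=
  quasiLocal_ext_ket fun c => by simp [actOn_edgeR_ket, mul_assoc]

@[simp] theorem edgeL_one (e : Edge) : edgeL e (1 : G) = 1 := by
  simp [edgeL, sum_matUnit]

@[simp] theorem edgeR_one (e : Edge) : edgeR e (1 : G) = 1 := by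
  simp [edgeR, sum_matUnit]

theorem star_edgeL (e : Edge) (h : G) : star (edgeL e h) = edgeL e h⁻¹ := by
  simp only [edgeL, star_sum, star_matUnit]
  exact Fintype.sum_equiv (Equiv.mulLeft h) _ _ fun g => by simp

theorem star_edgeR (e : Edge) (h : G) : star (edgeR e h) = edgeR e h⁻¹ := by
  simp only [edgeR, star_sum, star_matUnit]
  exact Fintype.sum_equiv (Equiv.mulRight h⁻¹) _ _ fun g => by simp

theorem edgeL_mem_unitary (e : Edge) (h : G) : edgeL e h ∈ unitary (quasiLocal G) := by
  constructor <;> rw [star_edgeL, edgeL_mul] <;> simp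

theorem edgeR_mem_unitary (e : Edge) (h : G) : edgeR e h ∈ unitary (quasiLocal G) := by
  constructor <;> rw [star_edgeR, edgeR_mul] <;> simp

end Configurations

/-! ## Ribbon multiplets -/

theorem sum_mul_mem_unitary {ι B : Type*} [Fintype ι] [DecidableEq ι] [Ring B] [StarRing B]
    {p u : ι → B} (hstar : ∀ i, star (p i) = p i)
    (hmul : ∀ i j, p i * p j = if i = j then p i else 0) (hsum : ∑ i, p i = 1)
    (hu : ∀ i, u i ∈ unitary B) (hcomm : ∀ i, Commute (p i) (u i)) :
    ∑ i, p i * u i ∈ unitary B := by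
  have hcomm' : ∀ i, p i * star (u i) = star (u i) * p i := fun i => by
    simpa [hstar] using congrArg star (hcomm i).eq.symm
  have left : ∀ i j, star (p i * u i) * (p j * u j) = if i = j then p i else 0 := fun i j => by
    rw [star_mul, hstar, mul_assoc, ← mul_assoc (p i), hmul]
    split_ifs with hij
    · rw [hij, (hcomm j).eq, ← mul_assoc, (hu j).1, one_mul]
    · rw [zero_mul, mul_zero]
  have right : ∀ i j, p i * u i * star (p j * u j) = if i = j then p i else 0 := fun i j => by
    rw [star_mul, hstar, (hcomm i).eq, ← hcomm', mul_assoc, ← mul_assoc (p i), hmul]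
    split_ifs with hij
    · rw [hij, hcomm', ← mul_assoc, (hu j).2, one_mul]
    · rw [zero_mul, mul_zero]
  rw [Unitary.mem_iff]
  constructor <;>
    simp only [star_sum, Finset.sum_mul_sum, left, right, Finset.sum_ite_eq, Finset.mem_univ,
      if_true, hsum]

section MatTensor

variable {ι A : Type*} [Ring A] [Algebra ℂ A]

/-- The elementary tensor `a ⊗ M` of an algebra element and a scalar matrix, as a matrix over the
algebra. -/
def matTensor (a : A) (M : Matrix ι ι ℂ) : Matrix ι ι A := M.map (· • a)

theorem matTensor_apply (a : A) (M : Matrix ι ι ℂ) (i j : ι) : matTensor a M i j = M i j • a := rfl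

theorem matTensor_zero_left (M : Matrix ι ι ℂ) : matTensor (0 : A) M = 0 := by
  ext i j
  rw [matTensor_apply, smul_zero, Matrix.zero_apply]

theorem matTensor_zero_right (a : A) : matTensor a (0 : Matrix ι ι ℂ) = 0 := by
  ext i j
  rw [matTensor_apply, Matrix.zero_apply, zero_smul, Matrix.zero_apply]

theorem matTensor_sum_left {κ : Type*} (s : Finset κ) (a : κ → A) (M : Matrix ι ι ℂ) :
    matTensor (∑ k ∈ s, a k) M = ∑ k ∈ s, matTensor (a k) M := by
  ext i j
  simp only [matTensor_apply, Matrix.sum_apply, Finset.smul_sum]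

theorem matTensor_sum_right {κ : Type*} (s : Finset κ) (a : A) (M : κ → Matrix ι ι ℂ) :
    matTensor a (∑ k ∈ s, M k) = ∑ k ∈ s, matTensor a (M k) := by
  ext i j
  simp only [matTensor_apply, Matrix.sum_apply, Finset.sum_smul]

theorem conjTranspose_matTensor [StarRing A] [StarModule ℂ A] (a : A) (M : Matrix ι ι ℂ) :
    (matTensor a M)ᴴ = matTensor (star a) Mᴴ := by
  ext i j
  simp [matTensor_apply]

theorem matTensor_mul [Fintype ι] (a b : A) (M N : Matrix ι ι ℂ) :
    matTensor a M * matTensor b N = matTensor (a * b) (M * N) := by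
  ext i j
  simp only [matTensor_apply, Matrix.mul_apply, Finset.sum_smul, smul_mul_smul_comm]

variable [DecidableEq ι]

theorem matTensor_one_one : matTensor (1 : A) (1 : Matrix ι ι ℂ) = 1 := by
  ext i j
  rw [matTensor_apply, Matrix.one_apply, Matrix.one_apply, ite_smul, one_smul, zero_smul]

variable [Fintype ι]

theorem matTensor_eq_left_mul_right (a : A) (M : Matrix ι ι ℂ) :
    matTensor a M = matTensor a 1 * matTensor 1 M := by
  rw [matTensor_mul, mul_one, one_mul]

theorem matTensor_eq_right_mul_left (a : A) (M : Matrix ι ι ℂ) :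
    matTensor a M = matTensor 1 M * matTensor a 1 := by
  rw [matTensor_mul, mul_one, one_mul]

theorem commute_matTensor (a : A) (M : Matrix ι ι ℂ) :
    Commute (matTensor a 1) (matTensor 1 M) := by
  rw [commute_iff_eq, ← matTensor_eq_left_mul_right, ← matTensor_eq_right_mul_left]

variable [StarRing A] [StarModule ℂ A]

theorem matTensor_mem_unitary {a : A} {M : Matrix ι ι ℂ} (ha : a ∈ unitary A)
    (hM : M ∈ unitary (Matrix ι ι ℂ)) : matTensor a M ∈ unitary (Matrix ι ι A) := by
  rw [Unitary.mem_iff, Matrix.star_eq_conjTranspose, conjTranspose_matTensor, matTensor_mul,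
    matTensor_mul, ← Matrix.star_eq_conjTranspose, ha.1, ha.2, hM.1, hM.2, matTensor_one_one]
  exact ⟨rfl, rfl⟩

variable {κ : Type*} [Fintype κ] [DecidableEq κ]

theorem sum_matTensor_mem_unitary_of_left {p : κ → A} {U : κ → Matrix ι ι ℂ}
    (hstar : ∀ k, star (p k) = p k) (hmul : ∀ k l, p k * p l = if k = l then p k else 0)
    (hsum : ∑ k, p k = 1) (hU : ∀ k, U k ∈ unitary (Matrix ι ι ℂ)) :
    ∑ k, matTensor (p k) (U k) ∈ unitary (Matrix ι ι A) := by
  rw [Finset.sum_congr rfl fun k _ => matTensor_eq_left_mul_right (p k) (U k)]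
  refine sum_mul_mem_unitary (fun k => ?_) (fun k l => ?_) ?_
    (fun k => matTensor_mem_unitary (one_mem _) (hU k)) fun k => commute_matTensor _ _
  · rw [Matrix.star_eq_conjTranspose, conjTranspose_matTensor, hstar, Matrix.conjTranspose_one]
  · rw [matTensor_mul, hmul, mul_one, apply_ite (matTensor · 1), matTensor_zero_left]
  · rw [← matTensor_sum_left, hsum, matTensor_one_one]

theorem sum_matTensor_mem_unitary_of_right {u : κ → A} {P : κ → Matrix ι ι ℂ}
    (hu : ∀ k, u k ∈ unitary A) (hstar : ∀ k, (P k)ᴴ = P k)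
    (hmul : ∀ k l, P k * P l = if k = l then P k else 0) (hsum : ∑ k, P k = 1) :
    ∑ k, matTensor (u k) (P k) ∈ unitary (Matrix ι ι A) := by
  rw [Finset.sum_congr rfl fun k _ => matTensor_eq_right_mul_left (u k) (P k)]
  refine sum_mul_mem_unitary (fun k => ?_) (fun k l => ?_) ?_
    (fun k => matTensor_mem_unitary (hu k) (one_mem _)) fun k => (commute_matTensor _ _).symm
  · rw [Matrix.star_eq_conjTranspose, conjTranspose_matTensor, hstar, star_one]
  · rw [matTensor_mul, hmul, mul_one, apply_ite (matTensor 1), matTensor_zero_right]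
  · rw [← matTensor_sum_right, hsum, matTensor_one_one]

end MatTensor

namespace QuantumDouble

variable {G : Type*} [Group G] [Fintype G] [DecidableEq G]

theorem coeff_sum {ι : Type*} (s : Finset ι) (a : ι → QuantumDouble G) (x y : G) :
    (∑ i ∈ s, a i).coeff x y = ∑ i ∈ s, (a i).coeff x y :=
  map_sum (⟨⟨fun b => b.coeff x y, rfl⟩, fun _ _ => rfl⟩ : QuantumDouble G →+ ℂ) a s

theorem sum_of_one : ∑ g : G, of g 1 = 1 := by
  ext x y
  by_cases hy : y = 1 <;> simp [coeff_sum, coeff_one, coeff_of, hy]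

theorem sum_of_mul_sum_of (h h' : G) :
    (∑ g, of g h) * ∑ g, of g h' = ∑ g : G, of g (h * h') := by
  rw [Finset.sum_mul_sum]
  refine Finset.sum_congr rfl fun g _ => ?_
  rw [Finset.sum_eq_single_of_mem (h⁻¹ * g * h) (Finset.mem_univ _), of_mul_of, if_pos (by group)]
  rintro g' - hg'
  rw [of_mul_of, if_neg]
  rintro rfl
  exact hg' (by group)

theorem star_sum_of (h : G) : star (∑ g, of g h) = ∑ g : G, of g h⁻¹ := by
  simp only [star_sum, star_of]
  exact Fintype.sum_equiv (MulAut.conj h⁻¹).toEquiv _ _ fun g => by simp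

theorem sum_of_mem_unitary (h : G) : ∑ g, of g h ∈ unitary (QuantumDouble G) := by
  rw [Unitary.mem_iff, star_sum_of, sum_of_mul_sum_of, sum_of_mul_sum_of, inv_mul_cancel,
    mul_inv_cancel, sum_of_one]
  exact ⟨rfl, rfl⟩

end QuantumDouble

theorem Edge.source_ne_target (e : Edge) : e.source ≠ e.target := by
  rcases e with ⟨⟨a, b⟩, d⟩
  fin_cases d <;> simp [Edge.target]

theorem Edge.left_ne_right (e : Edge) : e.left ≠ e.right := by
  rcases e with ⟨⟨a, b⟩, d⟩
  fin_cases d <;> simp [Edge.left, Edge.right]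

section TriangleOperators

variable {G : Type*} [Group G] [DecidableEq G]

/-- The operator `T_τ^g` of a direct triangle `τ` with initial site `s₀` and edge `e`. -/
noncomputable def directOp (s₀ : Site) (e : Edge) (g : G) : quasiLocal G :=
  if s₀.vertex = e.source then edgeT e g else edgeT e g⁻¹

theorem star_directOp (s₀ : Site) (e : Edge) (g : G) :
    star (directOp s₀ e g) = directOp s₀ e g := by
  unfold directOp
  split_ifs <;> exact star_edgeT _ _

theorem directOp_mul (s₀ : Site) (e : Edge) (g h : G) :
    directOp s₀ e g * directOp s₀ e h = if g = h then directOp s₀ e g else 0 := by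
  unfold directOp
  split_ifs <;> simp_all [edgeT_mul]

theorem directOp_inv {s₀ s₁ : Site} {e : Edge}
    (he : (s₀.vertex = e.source ∧ s₁.vertex = e.target) ∨
      (s₀.vertex = e.target ∧ s₁.vertex = e.source)) (g : G) :
    directOp s₁ e g⁻¹ = directOp s₀ e g := by
  rcases he with ⟨h0, h1⟩ | ⟨h0, h1⟩ <;> simp [directOp, h0, h1, e.source_ne_target.symm]

variable [Fintype G]

theorem sum_directOp (s₀ : Site) (e : Edge) : ∑ g : G, directOp s₀ e g = 1 := by
  unfold directOp
  split_ifs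
  · exact sum_edgeT e
  · rw [← sum_edgeT e]
    exact Fintype.sum_equiv (Equiv.inv G) _ _ fun _ => rfl

theorem triangleOp_direct (s₀ s₁ : Site) (e : Edge) (hf he) (h g : G) :
    triangleOp (.direct s₀ s₁ e hf he) h g = directOp s₀ e g := rfl

/-- The operator `L_τ^h` of a dual triangle `τ` with initial site `s₀` and edge `e`. -/
noncomputable def dualOp (s₀ : Site) (e : Edge) (h : G) : quasiLocal G :=
  if s₀.face = e.right then
    if s₀.vertex = e.source then edgeL e h else edgeR e h⁻¹
  else
    if s₀.vertex = e.source then edgeL e h⁻¹ else edgeR e h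

theorem dualOp_mem_unitary (s₀ : Site) (e : Edge) (h : G) :
    dualOp s₀ e h ∈ unitary (quasiLocal G) := by
  unfold dualOp
  split_ifs
  exacts [edgeL_mem_unitary _ _, edgeR_mem_unitary _ _, edgeL_mem_unitary _ _,
    edgeR_mem_unitary _ _]

theorem triangleOp_dual (s₀ s₁ : Site) (e : Edge) (hv he) (h g : G) :
    triangleOp (.dual s₀ s₁ e hv he) h g = if g = 1 then dualOp s₀ e h else 0 := rfl

theorem star_dualOp {s₀ s₁ : Site} {e : Edge} (hv : s₀.vertex = s₁.vertex)
    (he : (s₀.face = e.right ∧ s₁.face = e.left) ∨ (s₀.face = e.left ∧ s₁.face = e.right))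
    (h : G) : star (dualOp s₀ e h) = dualOp s₁ e h := by
  rcases he with ⟨h0, h1⟩ | ⟨h0, h1⟩ <;>
    simp only [dualOp, h0, h1, e.left_ne_right, if_true, if_false, hv] <;>
    split_ifs <;> simp [star_edgeL, star_edgeR]

end TriangleOperators

theorem oppRibbon_cons (τ : Triangle) (ρ : List Triangle) :
    oppRibbon (τ :: ρ) = oppRibbon ρ ++ [τ.opp] := by
  simp [oppRibbon]

section Multiplets

variable {G : Type*} [Group G] [Fintype G] [DecidableEq G] {n : ℕ}
  (D : QuantumDouble G →⋆ₐ[ℂ] Matrix (Fin n) (Fin n) ℂ)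

theorem conjTranspose_map_of (g h : G) :
    (D (.of g h))ᴴ = D (.of (h⁻¹ * g * h) h⁻¹) := by
  rw [← QuantumDouble.star_of, map_star, Matrix.star_eq_conjTranspose]

/-- The multiplet `𝐅_τ^D = ∑_{g,h} F_τ^{g,h} ⊗ D(g, h)` of a single triangle. -/
noncomputable def triangleMultiplet (τ : Triangle) : Matrix (Fin n) (Fin n) (quasiLocal G) :=
  ∑ g, ∑ h, matTensor (triangleOp τ g h) (D (.of g h))

theorem triangleMultiplet_direct (s₀ s₁ : Site) (e : Edge) (hf he) :
    triangleMultiplet D (.direct s₀ s₁ e hf he) =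
      ∑ h, matTensor (directOp s₀ e h) (D (∑ g, .of g h)) := by
  simp only [triangleMultiplet, triangleOp_direct, map_sum, matTensor_sum_right]
  exact Finset.sum_comm

theorem triangleMultiplet_dual (s₀ s₁ : Site) (e : Edge) (hv he) :
    triangleMultiplet D (.dual s₀ s₁ e hv he) = ∑ g, matTensor (dualOp s₀ e g) (D (.of g 1)) := by
  refine Finset.sum_congr rfl fun g _ => ?_
  rw [Finset.sum_eq_single_of_mem 1 (Finset.mem_univ _), triangleOp_dual, if_pos rfl]
  intro h _ hh
  rw [triangleOp_dual, if_neg hh, matTensor_zero_left]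

theorem triangleMultiplet_opp (τ : Triangle) :
    triangleMultiplet D τ.opp = (triangleMultiplet D τ)ᴴ := by
  cases τ with
  | direct s₀ s₁ e hf he =>
    rw [Triangle.opp, triangleMultiplet_direct, triangleMultiplet_direct,
      Matrix.conjTranspose_sum]
    refine Fintype.sum_equiv (Equiv.inv G) _ _ fun h => ?_
    rw [conjTranspose_matTensor, star_directOp, ← Matrix.star_eq_conjTranspose, ← map_star,
      QuantumDouble.star_sum_of, Equiv.inv_apply, inv_inv, ← directOp_inv he, inv_inv]
  | dual s₀ s₁ e hv he =>
    rw [Triangle.opp, triangleMultiplet_dual, triangleMultiplet_dual, Matrix.conjTranspose_sum]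
    refine Finset.sum_congr rfl fun g _ => ?_
    rw [conjTranspose_matTensor, star_dualOp hv he, conjTranspose_map_of, inv_one, one_mul,
      mul_one]

theorem triangleMultiplet_mem_unitary (τ : Triangle) :
    triangleMultiplet D τ ∈ unitary (Matrix (Fin n) (Fin n) (quasiLocal G)) := by
  cases τ with
  | direct s₀ s₁ e hf he =>
    rw [triangleMultiplet_direct]
    exact sum_matTensor_mem_unitary_of_left (star_directOp s₀ e) (directOp_mul s₀ e)
      (sum_directOp s₀ e) fun h => Unitary.map_mem D (QuantumDouble.sum_of_mem_unitary h)
  | dual s₀ s₁ e hv he =>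
    rw [triangleMultiplet_dual]
    refine sum_matTensor_mem_unitary_of_right (dualOp_mem_unitary s₀ e) (fun g => ?_)
      (fun g h => ?_) ?_
    · simp [conjTranspose_map_of]
    · rw [← map_mul, QuantumDouble.of_mul_of]
      simp [apply_ite D]
    · rw [← map_sum, QuantumDouble.sum_of_one, map_one]

theorem ribbonMultiplet_eq_sum (ρ : List Triangle) :
    ribbonMultiplet D ρ = ∑ g, ∑ h, matTensor (ribbonOp ρ g h) (D (.of g h)) := by
  ext i j : 1
  simp only [ribbonMultiplet, Matrix.of_apply, Matrix.sum_apply, matTensor_apply]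

@[simp] theorem ribbonMultiplet_nil : ribbonMultiplet D [] = 1 := by
  have trivial_op (g : G) :
      ∑ h, matTensor (ribbonOp [] g h) (D (.of g h)) = matTensor 1 (D (.of g 1)) := by
    rw [Finset.sum_eq_single_of_mem 1 (Finset.mem_univ _), ribbonOp, if_pos rfl]
    intro h _ hh
    rw [ribbonOp, if_neg hh, matTensor_zero_left]
  simp only [ribbonMultiplet_eq_sum, trivial_op]
  rw [← matTensor_sum_right, ← map_sum, QuantumDouble.sum_of_one, map_one, matTensor_one_one]

theorem ribbonMultiplet_cons (τ : Triangle) (ρ : List Triangle) :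
    ribbonMultiplet D (τ :: ρ) = triangleMultiplet D τ * ribbonMultiplet D ρ := by
  simp only [ribbonMultiplet_eq_sum, triangleMultiplet, ribbonOp, Finset.sum_mul,
    matTensor_sum_left]
  refine Finset.sum_congr rfl fun g _ => ?_
  rw [Finset.sum_comm]
  refine Finset.sum_congr rfl fun k _ => ?_
  rw [Finset.mul_sum]
  refine (Finset.sum_eq_single_of_mem (k⁻¹ * g * k) (Finset.mem_univ _) ?_).trans ?_ |>.symm
  · intro g' _ hg'
    rw [Finset.mul_sum]
    refine Finset.sum_eq_zero fun h _ => ?_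
    rw [matTensor_mul, ← map_mul D, QuantumDouble.of_mul_of, if_neg, map_zero,
      matTensor_zero_right]
    rintro rfl
    exact hg' (by group)
  · rw [Finset.mul_sum]
    refine (Fintype.sum_equiv (Equiv.mulLeft k⁻¹) _ _ fun h => ?_).symm
    rw [Equiv.coe_mulLeft, matTensor_mul, ← map_mul D, QuantumDouble.of_mul_of,
      if_pos (by group), mul_inv_cancel_left]

theorem ribbonMultiplet_append (ρ ρ' : List Triangle) :
    ribbonMultiplet D (ρ ++ ρ') = ribbonMultiplet D ρ * ribbonMultiplet D ρ' := by
  induction ρ with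
  | nil => simp
  | cons τ ρ ih => rw [List.cons_append, ribbonMultiplet_cons, ribbonMultiplet_cons, ih, mul_assoc]

theorem ribbonMultiplet_mem_unitary (ρ : List Triangle) :
    ribbonMultiplet D ρ ∈ unitary (Matrix (Fin n) (Fin n) (quasiLocal G)) := by
  induction ρ with
  | nil => rw [ribbonMultiplet_nil]; exact one_mem _
  | cons τ ρ ih => rw [ribbonMultiplet_cons]; exact mul_mem (triangleMultiplet_mem_unitary D τ) ih

theorem ribbonMultiplet_oppRibbon (ρ : List Triangle) :
    ribbonMultiplet D (oppRibbon ρ) = (ribbonMultiplet D ρ)ᴴ := by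
  induction ρ with
  | nil => simp [oppRibbon]
  | cons τ ρ ih =>
    rw [oppRibbon_cons, ribbonMultiplet_append, ih, ribbonMultiplet_cons, ribbonMultiplet_nil,
      mul_one, triangleMultiplet_opp, ribbonMultiplet_cons, Matrix.conjTranspose_mul]

end Multiplets

/-! ## Local observables and amplimorphisms -/

theorem cauchySeq_of_dense {X α : Type*} [TopologicalSpace X] [UniformSpace α] {F : ℕ → X → α}
    (hF : Equicontinuous F) {S : Set X} (hS : Dense S) (h : ∀ x ∈ S, CauchySeq fun m => F m x)
    (x : X) : CauchySeq fun m => F m x := by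
  rw [cauchySeq_iff]
  intro V hV
  obtain ⟨W, hW, _, hWV⟩ := comp_comp_symm_mem_uniformity_sets hV
  obtain ⟨y, hyx, hyS⟩ := mem_closure_iff_nhds.1 (hS x) _ (hF x W hW)
  obtain ⟨N, hN⟩ := cauchySeq_iff.1 (h y hyS) W hW
  exact ⟨N, fun k hk l hl => hWV
    (SetRel.prodMk_mem_comp (SetRel.prodMk_mem_comp (hyx k) (hN k hk l hl))
      (SetRel.symm W (hyx l)))⟩

theorem norm_le_one_of_sum_mul_star_eq_one {A ι : Type*} [CStarAlgebra A] [PartialOrder A]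
    [StarOrderedRing A] [Fintype ι] {a : ι → A} (h : ∑ k, a k * star (a k) = 1) (k : ι) :
    ‖a k‖ ≤ 1 := by
  have hle : a k * star (a k) ≤ 1 :=
    h ▸ Finset.single_le_sum (fun l _ => mul_star_self_nonneg (a l)) (Finset.mem_univ k)
  have hsq : ‖a k‖ * ‖a k‖ ≤ 1 :=
    CStarRing.norm_self_mul_star (x := a k) ▸
      (CStarAlgebra.norm_le_one_iff_of_nonneg _ (mul_star_self_nonneg (a k))).2 hle
  exact (sq_le_one_iff₀ (norm_nonneg _)).1 ((sq _).trans_le hsq)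

section Local

variable {G : Type*} [Group G] [DecidableEq G]

theorem localAlgebra_isClosed (X : Set Edge) :
    IsClosed (localAlgebra G X : Set (RefSpace G →L[ℂ] RefSpace G)) :=
  StarSubalgebra.isClosed_topologicalClosure _

theorem quasiLocal_completeSpace : CompleteSpace (quasiLocal G) :=
  (localAlgebra_isClosed (G := G) Set.univ).completeSpace_coe

section Representation

variable {H : Type*} [NormedAddCommGroup H] [InnerProductSpace ℂ H] [CompleteSpace H]

theorem norm_rep_le (π : quasiLocal G →⋆ₐ[ℂ] (H →L[ℂ] H)) (a : quasiLocal G) : ‖π a‖ ≤ ‖a‖ := by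
  have := localAlgebra_isClosed (G := G) Set.univ
  exact NonUnitalStarAlgHom.norm_apply_le π a

theorem continuous_rep (π : quasiLocal G →⋆ₐ[ℂ] (H →L[ℂ] H)) : Continuous π :=
  AddMonoidHomClass.continuous_of_bound π 1 fun a => by rw [one_mul]; exact norm_rep_le π a

end Representation

variable (G) in
/-- The algebra of local observables, encoded as those observables that commute with the matrix
units of all but finitely many edges. -/
def localObs : StarSubalgebra ℂ (quasiLocal G) where
  carrier := {a | ∃ E : Set Edge, E.Finite ∧ ∀ e ∉ E, ∀ g h, Commute a (matUnit e g h)}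
  mul_mem' := by
    rintro a b ⟨E, hE, ha⟩ ⟨E', hE', hb⟩
    exact ⟨E ∪ E', hE.union hE', fun e he g h =>
      (ha e (fun h => he (.inl h)) g h).mul_left (hb e (fun h => he (.inr h)) g h)⟩
  add_mem' := by
    rintro a b ⟨E, hE, ha⟩ ⟨E', hE', hb⟩
    exact ⟨E ∪ E', hE.union hE', fun e he g h =>
      (ha e (fun h => he (.inl h)) g h).add_left (hb e (fun h => he (.inr h)) g h)⟩
  algebraMap_mem' z := ⟨∅, Set.finite_empty, fun e _ g h => Algebra.commutes z _⟩
  star_mem' := by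
    rintro a ⟨E, hE, ha⟩
    refine ⟨E, hE, fun e he g h => ?_⟩
    simpa only [star_matUnit] using (ha e he h g).star_star

theorem matUnit_mem_localObs (e : Edge) (g h : G) : matUnit e g h ∈ localObs G :=
  ⟨{e}, Set.finite_singleton e, fun _ he' g' h' => commute_matUnit (Ne.symm he') g h g' h'⟩

theorem dense_localObs : Dense (localObs G : Set (quasiLocal G)) := by
  have hadj : StarAlgebra.adjoin ℂ {T | ∃ e ∈ (Set.univ : Set Edge), ∃ g h : G,
      T = matUnitOp e g h} ≤ (localObs G).map (quasiLocal G).subtype := by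
    refine StarAlgebra.adjoin_le ?_
    rintro _ ⟨e, _, g, h, rfl⟩
    exact ⟨matUnit e g h, matUnit_mem_localObs e g h, rfl⟩
  rw [Subtype.dense_iff]
  exact fun T hT => closure_mono hadj hT

variable [Fintype G]

theorem triangleOp_mem {C : Subalgebra ℂ (quasiLocal G)} {τ : Triangle}
    (hC : ∀ g h, matUnit τ.edge g h ∈ C) (g h : G) : triangleOp τ g h ∈ C := by
  cases τ with
  | direct s₀ s₁ e hf he =>
    simp only [triangleOp]
    split_ifs <;> exact hC _ _
  | dual s₀ s₁ e hv he =>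
    have hL : ∀ x, edgeL e x ∈ C := fun _ => sum_mem fun _ _ => hC _ _
    have hR : ∀ x, edgeR e x ∈ C := fun _ => sum_mem fun _ _ => hC _ _
    simp only [triangleOp]
    split_ifs
    exacts [hL _, hR _, hL _, hR _, zero_mem _]

theorem ribbonOp_mem {C : Subalgebra ℂ (quasiLocal G)} {ρ : List Triangle}
    (hC : ∀ τ ∈ ρ, ∀ g h, matUnit τ.edge g h ∈ C) (g h : G) : ribbonOp ρ g h ∈ C := by
  induction ρ generalizing g h with
  | nil =>
    simp only [ribbonOp]
    split_ifs
    exacts [one_mem _, zero_mem _]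
  | cons τ ρ ih =>
    rw [List.forall_mem_cons] at hC
    exact sum_mem fun k _ => mul_mem (triangleOp_mem hC.1 _ _) (ih hC.2 _ _)

variable {n : ℕ} (D : QuantumDouble G →⋆ₐ[ℂ] Matrix (Fin n) (Fin n) ℂ)

theorem ribbonMultiplet_mem {C : Subalgebra ℂ (quasiLocal G)} {ρ : List Triangle}
    (hC : ∀ τ ∈ ρ, ∀ g h, matUnit τ.edge g h ∈ C) (i j : Fin n) : ribbonMultiplet D ρ i j ∈ C :=
  sum_mem fun _ _ => sum_mem fun _ _ => C.smul_mem (ribbonOp_mem hC _ _) _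

theorem commute_ribbonMultiplet {a : quasiLocal G} {ρ : List Triangle}
    (ha : ∀ τ ∈ ρ, ∀ g h, Commute a (matUnit τ.edge g h)) (i j : Fin n) :
    Commute a (ribbonMultiplet D ρ i j) :=
  (Subalgebra.mem_centralizer_iff ℂ).1 (ribbonMultiplet_mem D (C := .centralizer ℂ {a})
    (fun τ hτ g h => (Subalgebra.mem_centralizer_iff ℂ).2 (by rintro _ rfl; exact ha τ hτ g h)) i j)
    a rfl

theorem commute_diagonal_ribbonMultiplet {a : quasiLocal G} {ρ : List Triangle}
    (ha : ∀ τ ∈ ρ, ∀ g h, Commute a (matUnit τ.edge g h)) :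
    Commute (Matrix.diagonal fun _ => a) (ribbonMultiplet D ρ) := by
  ext i j : 1
  rw [Matrix.diagonal_mul, Matrix.mul_diagonal]
  exact commute_ribbonMultiplet D ha i j

theorem ribbonMultiplet_mem_localAlgebra {X : Set Edge} {ρ : List Triangle}
    (hρ : ∀ τ ∈ ρ, τ.edge ∈ X) (i j : Fin n) :
    (ribbonMultiplet D ρ i j : RefSpace G →L[ℂ] RefSpace G) ∈ localAlgebra G X :=
  ribbonMultiplet_mem D
    (C := (localAlgebra G X).toSubalgebra.comap (quasiLocal G).subtype.toAlgHom)
    (fun τ hτ g h => StarSubalgebra.le_topologicalClosure _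
      (StarAlgebra.subset_adjoin ℂ _ ⟨τ.edge, hρ τ hτ, g, h, rfl⟩)) i j

theorem norm_ribbonMultiplet_le (ρ : List Triangle) (i j : Fin n) :
    ‖ribbonMultiplet D ρ i j‖ ≤ 1 := by
  have hrow : ∑ k, ribbonMultiplet D ρ i k * star (ribbonMultiplet D ρ i k) = 1 := by
    have hU : ribbonMultiplet D ρ * (ribbonMultiplet D ρ)ᴴ = 1 :=
      (ribbonMultiplet_mem_unitary D ρ).2
    rw [← Matrix.one_apply_eq i, ← hU, Matrix.mul_apply]
    rfl
  have hrow' := congrArg (quasiLocal G).subtype hrow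
  rw [map_sum, map_one] at hrow'
  exact norm_le_one_of_sum_mul_star_eq_one
    (a := fun k => (ribbonMultiplet D ρ i k : RefSpace G →L[ℂ] RefSpace G)) hrow' j

theorem finiteAmpli_apply (ρ : List Triangle) (O : quasiLocal G) (i j : Fin n) :
    finiteAmpli D ρ O i j =
      ∑ k, ribbonMultiplet D ρ i k * O * star (ribbonMultiplet D ρ j k) := by
  rw [finiteAmpli, Matrix.mul_apply]
  simp only [Matrix.mul_diagonal, Matrix.conjTranspose_apply]

theorem lipschitzWith_finiteAmpli (ρ : List Triangle) (i j : Fin n) :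
    LipschitzWith n fun O : quasiLocal G => finiteAmpli D ρ O i j := by
  refine LipschitzWith.of_dist_le_mul fun O O' => ?_
  have hterm : ∀ k, ‖ribbonMultiplet D ρ i k * (O - O') * star (ribbonMultiplet D ρ j k)‖ ≤
      ‖O - O'‖ := fun k => calc
    _ ≤ ‖ribbonMultiplet D ρ i k‖ * ‖O - O'‖ * ‖ribbonMultiplet D ρ j k‖ :=
      (norm_mul_le _ _).trans (mul_le_mul (norm_mul_le _ _)
        (norm_star (ribbonMultiplet D ρ j k)).le (norm_nonneg _) (by positivity))
    _ ≤ 1 * ‖O - O'‖ * 1 := by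
      gcongr <;> exact norm_ribbonMultiplet_le D ρ _ _
    _ = ‖O - O'‖ := by rw [one_mul, mul_one]
  simp only [dist_eq_norm, finiteAmpli_apply, ← Finset.sum_sub_distrib, ← sub_mul, ← mul_sub]
  exact (norm_sum_le _ _).trans ((Finset.sum_le_sum fun k _ => hterm k).trans (by simp))

theorem equicontinuous_finiteAmpli (ρ : ℕ → List Triangle) (i j : Fin n) :
    Equicontinuous fun m (O : quasiLocal G) => finiteAmpli D (ρ m) O i j :=
  (LipschitzWith.uniformEquicontinuous _ n
    fun m => lipschitzWith_finiteAmpli D (ρ m) i j).equicontinuous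

namespace HalfInfiniteRibbon

/-- The stretch of a half-infinite ribbon from triangle number `K` up to, but excluding, triangle
number `m`. -/
def segment (ρ : HalfInfiniteRibbon) (K m : ℕ) : List Triangle := (List.Ico K m).map ρ.tri

theorem segment_zero (ρ : HalfInfiniteRibbon) (m : ℕ) : ρ.segment 0 m = ρ.initial m := by
  rw [segment, initial, List.Ico.zero_bot]

theorem segment_append (ρ : HalfInfiniteRibbon) {K N m : ℕ} (h : K ≤ N) (h' : N ≤ m) :
    ρ.segment K N ++ ρ.segment N m = ρ.segment K m := by
  rw [segment, segment, segment, ← List.map_append, List.Ico.append_consecutive h h']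

theorem eventually_segment_edge_notMem (ρ : HalfInfiniteRibbon) {E : Set Edge} (hE : E.Finite) :
    ∀ᶠ K in atTop, ∀ m, ∀ τ ∈ ρ.segment K m, τ.edge ∉ E := by
  have htri : ∀ᶠ k in atTop, (ρ.tri k).edge ∉ E :=
    Nat.cofinite_eq_atTop ▸ ρ.edge_injective.tendsto_cofinite.eventually hE.compl_mem_cofinite
  refine (eventually_forall_ge_atTop.2 htri).mono fun K hK m => List.forall_mem_map.2 fun k hk => ?_
  exact hK k (List.Ico.mem.1 hk).1

end HalfInfiniteRibbon

theorem finiteAmpli_append {ρ ρ' : List Triangle} {O : quasiLocal G}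
    (h : ∀ τ ∈ ρ', ∀ g h, Commute O (matUnit τ.edge g h)) :
    finiteAmpli D (ρ ++ ρ') O = finiteAmpli D ρ O := by
  have hunitary : ribbonMultiplet D ρ' * (ribbonMultiplet D ρ')ᴴ = 1 :=
    (ribbonMultiplet_mem_unitary D ρ').2
  have hcomm := (commute_diagonal_ribbonMultiplet D h).eq
  calc finiteAmpli D (ρ ++ ρ') O
      = ribbonMultiplet D ρ * (ribbonMultiplet D ρ' * Matrix.diagonal fun _ => O) *
          (ribbonMultiplet D ρ')ᴴ * (ribbonMultiplet D ρ)ᴴ := by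
        rw [finiteAmpli, ribbonMultiplet_append, Matrix.conjTranspose_mul]
        simp only [mul_assoc]
    _ = ribbonMultiplet D ρ * (Matrix.diagonal fun _ => O) *
          (ribbonMultiplet D ρ' * (ribbonMultiplet D ρ')ᴴ) * (ribbonMultiplet D ρ)ᴴ := by
        rw [← hcomm]
        simp only [mul_assoc]
    _ = finiteAmpli D ρ O := by rw [hunitary, mul_one, finiteAmpli]

theorem finiteAmpli_eventuallyEq_ampli (ρ : HalfInfiniteRibbon) {O : quasiLocal G}
    (hO : O ∈ localObs G) : ∀ᶠ m in atTop, finiteAmpli D (ρ.initial m) O = ampli D ρ O := by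
  obtain ⟨E, hE, hcomm⟩ := hO
  obtain ⟨K, hK⟩ := (ρ.eventually_segment_edge_notMem hE).exists
  have hconst : ∀ m ≥ K, finiteAmpli D (ρ.initial m) O = finiteAmpli D (ρ.initial K) O := by
    intro m hm
    rw [← ρ.segment_zero, ← ρ.segment_append K.zero_le hm, ρ.segment_zero]
    exact finiteAmpli_append D fun τ hτ => hcomm _ (hK m τ hτ)
  have hlim : ampli D ρ O = finiteAmpli D (ρ.initial K) O :=
    (tendsto_atTop_of_eventually_const hconst).limUnder_eq
  exact eventually_atTop.2 ⟨K, fun m hm => (hconst m hm).trans hlim.symm⟩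

theorem tendsto_finiteAmpli (ρ : HalfInfiniteRibbon) (O : quasiLocal G) :
    Tendsto (fun m => finiteAmpli D (ρ.initial m) O) atTop (𝓝 (ampli D ρ O)) := by
  have hcauchy : ∀ i j, CauchySeq fun m => finiteAmpli D (ρ.initial m) O i j := fun i j =>
    cauchySeq_of_dense (equicontinuous_finiteAmpli D ρ.initial i j) dense_localObs
      (fun O' hO' => (tendsto_const_nhds.congr' ((finiteAmpli_eventuallyEq_ampli D ρ hO').mono
        fun m hm => congrFun₂ hm.symm i j)).cauchySeq) O
  have := quasiLocal_completeSpace (G := G)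
  choose L hL using fun i j => cauchySeq_tendsto_of_complete (hcauchy i j)
  exact tendsto_nhds_limUnder
    ⟨Matrix.of L, tendsto_pi_nhds.2 fun i => tendsto_pi_nhds.2 fun j => hL i j⟩

theorem continuous_ampli_apply (ρ : HalfInfiniteRibbon) (i j : Fin n) :
    Continuous fun O : quasiLocal G => ampli D ρ O i j :=
  (tendsto_pi_nhds.2 fun O => tendsto_pi_nhds.1 (tendsto_pi_nhds.1
    (tendsto_finiteAmpli D ρ O) i) j).continuous_of_equicontinuous
    (equicontinuous_finiteAmpli D ρ.initial i j)

end Local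

/-! ## Crossings of dual edges and winding functions -/

/-- `IsPath s ρ s'` says that the triangles of `ρ` fit together and lead from `s` to `s'`. -/
def IsPath : Site → List Triangle → Site → Prop
  | s, [], s' => s = s'
  | s, τ :: ρ, s' => τ.first = s ∧ IsPath τ.final ρ s'

theorem isPath_of_isChain {τ τ' : Triangle} {ρ : List Triangle}
    (h : (τ :: (ρ ++ [τ'])).IsChain fun τ τ' => τ.final = τ'.first) :
    IsPath τ.first (τ :: (ρ ++ [τ'])) τ'.final := by
  induction ρ generalizing τ with
  | nil =>
    rw [List.nil_append, List.isChain_cons_cons] at h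
    exact ⟨rfl, h.1.symm, rfl⟩
  | cons τ'' ρ ih =>
    rw [List.cons_append, List.isChain_cons_cons] at h
    exact ⟨rfl, h.1 ▸ ih h.2⟩

/-- The signed crossing of an edge by the dual edge of a triangle; crossings from right to left
count as positive. -/
noncomputable def crossing : Triangle → Edge →₀ ℤ
  | .direct _ _ _ _ _ => 0
  | .dual s₀ _ e _ _ => Finsupp.single e (if s₀.face = e.right then 1 else -1)

/-- The signed crossings of edges by the dual edges of a list of triangles. -/
noncomputable def crossings (ρ : List Triangle) : Edge →₀ ℤ := (ρ.map crossing).sum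

@[simp] theorem crossings_nil : crossings [] = 0 := rfl

@[simp] theorem crossings_cons (τ : Triangle) (ρ : List Triangle) :
    crossings (τ :: ρ) = crossing τ + crossings ρ := by simp [crossings]

theorem crossings_append (ρ ρ' : List Triangle) :
    crossings (ρ ++ ρ') = crossings ρ + crossings ρ' := by simp [crossings]

theorem crossing_apply_eq_zero {τ : Triangle} {e : Edge} (h : τ.edge ≠ e) : crossing τ e = 0 := by
  cases τ with
  | direct => rfl
  | dual => exact Finsupp.single_eq_of_ne (Ne.symm h)

theorem crossings_apply_eq_zero {ρ : List Triangle} {e : Edge} (h : ∀ τ ∈ ρ, τ.edge ≠ e) :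
    crossings ρ e = 0 := by
  induction ρ with
  | nil => rfl
  | cons τ ρ ih =>
    rw [List.forall_mem_cons] at h
    rw [crossings_cons, Finsupp.add_apply, crossing_apply_eq_zero h.1, ih h.2, add_zero]

/-- The number of crossings into a face minus the number of crossings out of it. -/
noncomputable def influx : Face → (Edge →₀ ℤ) →+ ℤ
  | .up a b => Finsupp.applyAddHom ⟨(a, b), 0⟩ - Finsupp.applyAddHom ⟨(a, b), 1⟩ -
      Finsupp.applyAddHom ⟨(a, b + 1), 2⟩
  | .down a b => Finsupp.applyAddHom ⟨(a + 1, b), 1⟩ + Finsupp.applyAddHom ⟨(a, b + 1), 2⟩ -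
      Finsupp.applyAddHom ⟨(a, b + 1), 0⟩

theorem influx_up (a b : ℤ) (n : Edge →₀ ℤ) :
    influx (.up a b) n = n ⟨(a, b), 0⟩ - n ⟨(a, b), 1⟩ - n ⟨(a, b + 1), 2⟩ := rfl

theorem influx_down (a b : ℤ) (n : Edge →₀ ℤ) :
    influx (.down a b) n = n ⟨(a + 1, b), 1⟩ + n ⟨(a, b + 1), 2⟩ - n ⟨(a, b + 1), 0⟩ := rfl

theorem influx_single (f : Face) (e : Edge) (z : ℤ) : influx f (Finsupp.single e z) =
    (if e.left = f then z else 0) - (if e.right = f then z else 0) := by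
  rcases e with ⟨⟨x, y⟩, d⟩
  rcases f with ⟨a, b⟩ | ⟨a, b⟩ <;> fin_cases d <;>
    simp [influx_up, influx_down, Finsupp.single_apply, Edge.left, Edge.right] <;> grind

theorem influx_crossing (f : Face) (τ : Triangle) : influx f (crossing τ) =
    (if τ.final.face = f then 1 else 0) - (if τ.first.face = f then 1 else 0) := by
  cases τ with
  | direct s₀ s₁ e hf he =>
    simp only [crossing, Triangle.final, Triangle.first, hf, map_zero]
    exact (sub_self _).symm
  | dual s₀ s₁ e hv he =>
    simp only [crossing, Triangle.final, Triangle.first, influx_single]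
    rcases he with ⟨h0, h1⟩ | ⟨h0, h1⟩
    · simp only [h0, h1, if_true]
    · simp only [h0, h1, e.left_ne_right, if_false]
      split_ifs <;> simp

theorem influx_crossings (f : Face) {s s' : Site} {ρ : List Triangle} (h : IsPath s ρ s') :
    influx f (crossings ρ) = (if s'.face = f then 1 else 0) - (if s.face = f then 1 else 0) := by
  induction ρ generalizing s with
  | nil => cases h; rw [crossings_nil, map_zero, sub_self]
  | cons τ ρ ih => rw [crossings_cons, map_add, influx_crossing, ih h.2, h.1]; ring

/-- `w` is a winding function for the crossings `n`: it jumps by `n` across each edge. -/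
def IsWinding (n : Edge →₀ ℤ) (w : Vertex →₀ ℤ) : Prop :=
  ∀ e : Edge, w e.source - w e.target = n e

/-- The signed number of crossings of the horizontal lattice ray which starts at `v` and points to
the right. -/
noncomputable def rayCrossings (n : Edge →₀ ℤ) (v : Vertex) : ℤ :=
  n.sum fun e z => if e.dir = 0 ∧ e.source.2 = v.2 ∧ v.1 ≤ e.source.1 then z else 0

theorem exists_bound_source (n : Edge →₀ ℤ) :
    ∃ M, ∀ e, n e ≠ 0 → |e.source.1| < M ∧ |e.source.2| < M := by
  obtain ⟨M, hM⟩ := (n.support.image fun e => max |e.source.1| |e.source.2|).exists_le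
  refine ⟨M + 1, fun e he => ?_⟩
  have := hM _ (Finset.mem_image_of_mem _ (Finsupp.mem_support_iff.2 he))
  omega

section RayCrossings

variable {n : Edge →₀ ℤ} {M : ℤ}

theorem rayCrossings_eq_zero {v : Vertex} (h : ∀ x ≥ v.1, n ⟨(x, v.2), 0⟩ = 0) :
    rayCrossings n v = 0 := by
  refine Finset.sum_eq_zero fun e _ => ?_
  dsimp only
  split_ifs with he
  · rcases e with ⟨⟨x, y⟩, d⟩
    obtain ⟨rfl, rfl, hx⟩ := he
    exact h x hx
  · rfl

theorem rayCrossings_sub_succ_fst (n : Edge →₀ ℤ) (a b : ℤ) :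
    rayCrossings n (a, b) - rayCrossings n (a + 1, b) = n ⟨(a, b), 0⟩ := by
  have hsum : n ⟨(a, b), 0⟩ = n.sum fun e z => if e = ⟨(a, b), 0⟩ then z else 0 := by
    rw [Finsupp.sum_ite_self_eq']
  rw [hsum, rayCrossings, rayCrossings, Finsupp.sum, Finsupp.sum, Finsupp.sum,
    ← Finset.sum_sub_distrib]
  refine Finset.sum_congr rfl ?_
  rintro ⟨⟨x, y⟩, d⟩ -
  grind

theorem eq_zero_of_succ_eq {f : ℤ → ℤ} (hf : ∀ x, f x = f (x + 1)) (h : ∀ x ≥ M, f x = 0) (x : ℤ) :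
    f x = 0 := by
  rcases le_total M x with hx | hx
  · exact h x hx
  · induction x, hx using Int.leInductionDown with
    | base => exact h M le_rfl
    | pred x _ ih => rw [hf, sub_add_cancel, ih]

variable (hM : ∀ e, n e ≠ 0 → |e.source.1| < M ∧ |e.source.2| < M)
include hM

theorem apply_eq_zero_of_le {e : Edge} (he : M ≤ |e.source.1| ∨ M ≤ |e.source.2|) : n e = 0 := by
  by_contra h
  have := hM e h
  omega

variable (hn : ∀ f, influx f n = 0)
include hn

theorem rayCrossings_sub_succ_snd (a b : ℤ) :
    rayCrossings n (a, b) - rayCrossings n (a, b + 1) = n ⟨(a, b), 1⟩ := by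
  have hfar : ∀ x ≥ M, ∀ e : Edge, e.source.1 = x → n e = 0 := fun x hx e he =>
    apply_eq_zero_of_le hM (.inl ((hx.trans he.ge).trans (le_abs_self _)))
  refine sub_eq_zero.1 (eq_zero_of_succ_eq (M := M)
    (f := fun x => rayCrossings n (x, b) - rayCrossings n (x, b + 1) - n ⟨(x, b), 1⟩)
    (fun x => ?_) (fun x hx => ?_) a)
  · have hup := influx_up x b n
    have hdown := influx_down x b n
    rw [hn] at hup hdown
    linarith [rayCrossings_sub_succ_fst n x b, rayCrossings_sub_succ_fst n x (b + 1)]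
  · rw [rayCrossings_eq_zero fun y hy => hfar y (hx.trans hy) _ rfl,
      rayCrossings_eq_zero fun y hy => hfar y (hx.trans hy) _ rfl, hfar x hx _ rfl]
    rfl

theorem rayCrossings_sub_target (e : Edge) :
    rayCrossings n e.source - rayCrossings n e.target = n e := by
  rcases e with ⟨⟨a, b⟩, d⟩
  fin_cases d
  · exact rayCrossings_sub_succ_fst n a b
  · exact rayCrossings_sub_succ_snd hM hn a b
  · have hfst := rayCrossings_sub_succ_fst n a (b - 1)
    have hsnd := rayCrossings_sub_succ_snd hM hn a (b - 1)
    have hup := influx_up a (b - 1) n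
    rw [hn] at hup
    rw [sub_add_cancel] at hsnd hup
    change rayCrossings n (a, b) - rayCrossings n (a + 1, b - 1) = n ⟨(a, b), 2⟩
    linarith

theorem abs_lt_of_rayCrossings_ne_zero {v : Vertex} (hv : rayCrossings n v ≠ 0) :
    |v.1| < M ∧ |v.2| < M := by
  rcases v with ⟨a, b⟩
  have hsnd : ∀ x y, M ≤ |y| → rayCrossings n (x, y) = 0 := fun x y hy =>
    rayCrossings_eq_zero fun _ _ => apply_eq_zero_of_le hM (.inr hy)
  refine ⟨lt_of_not_ge fun ha => hv ?_, lt_of_not_ge fun hb => hv (hsnd a b hb)⟩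
  refine eq_zero_of_succ_eq (f := fun y => rayCrossings n (a, y)) (fun y => ?_)
    (fun y hy => hsnd a y (le_trans hy (le_abs_self y))) b
  rw [← sub_eq_zero, rayCrossings_sub_succ_snd hM hn]
  exact apply_eq_zero_of_le hM (.inl ha)

end RayCrossings

theorem exists_isWinding {n : Edge →₀ ℤ} (hn : ∀ f, influx f n = 0) : ∃ w, IsWinding n w := by
  obtain ⟨M, hM⟩ := exists_bound_source n
  have hfin : (Function.support (rayCrossings n)).Finite :=
    ((Set.finite_Ioo (-M) M).prod (Set.finite_Ioo (-M) M)).subset fun v hv =>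
      (abs_lt_of_rayCrossings_ne_zero hM hn hv).imp abs_lt.1 abs_lt.1
  exact ⟨Finsupp.ofSupportFinite _ hfin, rayCrossings_sub_target hM hn⟩

/-! ## Leaving a cone -/

/-- The point of the plane with given coordinates in the lattice basis. -/
noncomputable def latticePoint (x y : ℝ) : Plane := !₂[x + y / 2, √3 / 2 * y]

theorem norm_latticePoint_sq (x y : ℝ) : ‖latticePoint x y‖ ^ 2 = x ^ 2 + x * y + y ^ 2 := by
  have hsqrt : √3 ^ 2 = (3 : ℝ) := Real.sq_sqrt (by norm_num)
  rw [EuclideanSpace.norm_sq_eq, Fin.sum_univ_two]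
  simp only [latticePoint, Real.norm_eq_abs, sq_abs, Matrix.cons_val_zero, Matrix.cons_val_one]
  linear_combination y ^ 2 / 4 * hsqrt

theorem norm_latticePoint_le (x y : ℝ) : ‖latticePoint x y‖ ≤ |x| + |y| := by
  refine (sq_le_sq₀ (norm_nonneg _) (by positivity)).1 ?_
  rw [norm_latticePoint_sq, add_sq, sq_abs, sq_abs]
  have hxy : x * y ≤ |x| * |y| := abs_mul x y ▸ le_abs_self _
  have hnonneg : 0 ≤ |x| * |y| := by positivity
  linarith

theorem abs_le_norm_latticePoint (x y : ℝ) :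
    |x| ≤ 2 * ‖latticePoint x y‖ ∧ |y| ≤ 2 * ‖latticePoint x y‖ := by
  constructor <;> refine abs_le_of_sq_le_sq ?_ (by positivity) <;>
    rw [mul_pow, norm_latticePoint_sq] <;> nlinarith [sq_nonneg (x + 2 * y), sq_nonneg (2 * x + y)]

theorem latticePoint_sub (x y x' y' : ℝ) :
    latticePoint x y - latticePoint x' y' = latticePoint (x - x') (y - y') := by
  ext i; fin_cases i <;> simp [latticePoint] <;> ring

theorem pos_add_smul_latticePoint (v : Vertex) (t x y : ℝ) :
    v.pos + t • latticePoint x y = latticePoint (v.1 + t * x) (v.2 + t * y) := by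
  ext i; fin_cases i <;> simp [latticePoint, Vertex.pos] <;> ring

theorem exists_latticePoint_eq (u : Plane) : ∃ x y, latticePoint x y = u := by
  have hsqrt : √3 ≠ 0 := by positivity
  refine ⟨u 0 - u 1 / √3, 2 * u 1 / √3, ?_⟩
  ext i
  fin_cases i
  · change u 0 - u 1 / √3 + 2 * u 1 / √3 / 2 = u 0
    field_simp
    ring
  · simp [latticePoint]

theorem Edge.exists_mid_eq (e : Edge) : ∃ x y : ℝ, |x| ≤ 1 / 2 ∧ |y| ≤ 1 / 2 ∧
    e.mid = latticePoint (e.source.1 + x) (e.source.2 + y) := by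
  refine ⟨![1 / 2, 0, 1 / 2] e.dir, ![0, 1 / 2, -(1 / 2)] e.dir, ?_⟩
  rcases e with ⟨⟨a, b⟩, d⟩
  fin_cases d <;> refine ⟨by norm_num [abs_le], by norm_num [abs_le], ?_⟩ <;> ext i <;>
    fin_cases i <;>
    simp [latticePoint, Edge.mid, midpoint_eq_smul_add, Vertex.pos, Edge.target] <;> ring

theorem finite_edge_source_mem {S : Set Vertex} (hS : S.Finite) :
    {e : Edge | e.source ∈ S}.Finite :=
  ((hS.prod (Set.finite_univ (α := Fin 3))).image fun p => (⟨p.1, p.2⟩ : Edge)).subset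
    fun e he => ⟨(e.source, e.dir), ⟨he, Set.mem_univ _⟩, rfl⟩

theorem edgesIn_ball_finite (x : Plane) (r : ℝ) : (edgesIn (Metric.ball x r)).Finite := by
  obtain ⟨N, hN⟩ := exists_nat_gt (2 * (‖x‖ + r) + 1)
  refine (finite_edge_source_mem
    ((Set.finite_Icc (-N : ℤ) N).prod (Set.finite_Icc (-N : ℤ) N))).subset fun e he => ?_
  obtain ⟨y, z, hy, hz, hmid⟩ := e.exists_mid_eq
  have hlt : ‖e.mid‖ < ‖x‖ + r := by
    linarith [norm_le_norm_add_norm_sub' e.mid x, mem_ball_iff_norm.1 he]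
  rw [hmid] at hlt
  obtain ⟨h1, h2⟩ := abs_le_norm_latticePoint (e.source.1 + y) (e.source.2 + z)
  rw [abs_le] at h1 h2 hy hz
  refine ⟨⟨?_, ?_⟩, ⟨?_, ?_⟩⟩ <;> rify <;> linarith

theorem apply_eq_of_abs_sub_le_one {α : Type*} {w : Vertex → α} {v v' : Vertex}
    (hfst : |v'.1 - v.1| ≤ 1) (hsnd : |v'.2 - v.2| ≤ 1)
    (h : ∀ e : Edge, |e.source.1 - v.1| ≤ 1 → |e.source.2 - v.2| ≤ 1 → w e.source = w e.target) :
    w v = w v' := by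
  rcases v with ⟨i, j⟩
  rcases v' with ⟨i', j'⟩
  have hdir0 : ∀ x, |x - i| ≤ 1 → w (x, j) = w (x + 1, j) :=
    fun x hx => h ⟨(x, j), 0⟩ hx (by simp)
  have hdir1 : ∀ y, |y - j| ≤ 1 → w (i', y) = w (i', y + 1) := fun y hy => h ⟨(i', y), 1⟩ hfst hy
  have hi : i' = i ∨ i' = i + 1 ∨ i' = i - 1 := by rw [abs_le] at hfst; grind
  have hj : j' = j ∨ j' = j + 1 ∨ j' = j - 1 := by rw [abs_le] at hsnd; grind
  trans w (i', j)
  · rcases hi with rfl | rfl | rfl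
    · rfl
    · exact hdir0 i (by simp)
    · simpa using (hdir0 (i - 1) (by simp)).symm
  · rcases hj with rfl | rfl | rfl
    · rfl
    · exact hdir1 j (by simp)
    · simpa using (hdir1 (j - 1) (by simp)).symm

theorem abs_floor_sub_floor_le {x y : ℝ} (h : |x - y| ≤ 1) : |⌊x⌋ - ⌊y⌋| ≤ 1 := by
  rw [abs_le] at h
  have hxy : ⌊x⌋ ≤ ⌊y⌋ + 1 := Int.floor_add_one y ▸ Int.floor_le_floor (by linarith)
  have hyx : ⌊y⌋ ≤ ⌊x⌋ + 1 := Int.floor_add_one x ▸ Int.floor_le_floor (by linarith)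
  rw [abs_le]
  omega

theorem infinite_range_floor_mul {z : ℝ} (hz : z ≠ 0) :
    (Set.range fun t : ℕ => ⌊(t : ℝ) * z⌋).Infinite := by
  intro hfin
  rcases hz.lt_or_gt with hz | hz
  · exact not_bddBelow_of_tendsto_atBot (tendsto_floor_atBot.comp
      (tendsto_natCast_atTop_atTop.atTop_mul_const_of_neg hz)) hfin.bddBelow
  · exact not_bddAbove_of_tendsto_atTop (tendsto_floor_atTop.comp
      (tendsto_natCast_atTop_atTop.atTop_mul_const hz)) hfin.bddAbove

theorem eq_zero_of_const_along_lattice_ray {w : Vertex →₀ ℤ} {v : Vertex} {α β : ℝ} (hα : |α| ≤ 1)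
    (hβ : |β| ≤ 1) (h0 : α ≠ 0 ∨ β ≠ 0)
    (h : ∀ (t : ℕ) (e : Edge), |e.source.1 - (v.1 + t * α)| ≤ 2 →
      |e.source.2 - (v.2 + t * β)| ≤ 2 → w e.source = w e.target) : w v = 0 := by
  set r : ℕ → Vertex := fun t => (v.1 + ⌊(t : ℝ) * α⌋, v.2 + ⌊(t : ℝ) * β⌋) with hr
  have hnear : ∀ {x y : ℤ} {z : ℝ}, |x - (y + ⌊z⌋)| ≤ 1 → |(x : ℝ) - (y + z)| ≤ 2 := by
    intro x y z hx
    rw [abs_le] at hx ⊢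
    rify at hx
    constructor <;> linarith [Int.floor_le z, Int.lt_floor_add_one z]
  have hdist : ∀ (t : ℕ) {z : ℝ} (c : ℤ), |z| ≤ 1 →
      |(c + ⌊((t + 1 : ℕ) : ℝ) * z⌋) - (c + ⌊(t : ℝ) * z⌋)| ≤ 1 := by
    intro t z c hz
    rw [add_sub_add_left_eq_sub]
    exact abs_floor_sub_floor_le (by push_cast; ring_nf; exact hz)
  have hstep : ∀ t, w (r t) = w (r (t + 1)) := fun t =>
    apply_eq_of_abs_sub_le_one (hdist t v.1 hα) (hdist t v.2 hβ)
      fun e hx hy => h t e (hnear hx) (hnear hy)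
  have hconst : ∀ t, w (r t) = w v := by
    intro t
    induction t with
    | zero => simp [hr]
    | succ t ih => rw [← hstep, ih]
  by_contra hv
  have hfin : (Set.range r).Finite := w.support.finite_toSet.subset
    (Set.range_subset_iff.2 fun t => Finsupp.mem_support_iff.2 (hconst t ▸ hv))
  rcases h0 with hα0 | hβ0
  · refine infinite_range_floor_mul hα0 ((hfin.image fun x => x.1 - v.1).subset ?_)
    rintro _ ⟨t, rfl⟩
    exact ⟨r t, ⟨t, rfl⟩, add_sub_cancel_left _ _⟩
  · refine infinite_range_floor_mul hβ0 ((hfin.image fun x => x.2 - v.2).subset ?_)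
    rintro _ ⟨t, rfl⟩
    exact ⟨r t, ⟨t, rfl⟩, add_sub_cancel_left _ _⟩

theorem eq_zero_of_const_along_ray {w : Vertex →₀ ℤ} {v : Vertex} {u : Plane} (hu : ‖u‖ = 1)
    (h : ∀ (s : ℝ) (e : Edge), 0 ≤ s → ‖e.mid - (v.pos + s • u)‖ ≤ 5 → w e.source = w e.target) :
    w v = 0 := by
  -- Half the unit vector has lattice coordinates of modulus at most `1`.
  obtain ⟨α, β, hαβ⟩ := exists_latticePoint_eq ((1 / 2 : ℝ) • u)
  have hnorm : ‖latticePoint α β‖ = 1 / 2 := by rw [hαβ, norm_smul, hu]; norm_num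
  obtain ⟨hα, hβ⟩ := abs_le_norm_latticePoint α β
  rw [hnorm] at hα hβ
  refine eq_zero_of_const_along_lattice_ray (α := α) (β := β) (by linarith) (by linarith) ?_
    fun t e hx hy => h (t / 2) e (by positivity) ?_
  · by_contra! h0
    have hsq := norm_latticePoint_sq α β
    rw [hnorm, h0.1, h0.2] at hsq
    norm_num at hsq
  · obtain ⟨x, y, hx', hy', hmid⟩ := e.exists_mid_eq
    have hpoint : v.pos + ((t : ℝ) / 2) • u = latticePoint (v.1 + t * α) (v.2 + t * β) := by
      rw [← pos_add_smul_latticePoint, hαβ, smul_smul, mul_one_div]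
    rw [hmid, hpoint, latticePoint_sub]
    refine (norm_latticePoint_le _ _).trans ?_
    rw [add_sub_right_comm, add_sub_right_comm _ y]
    linarith [abs_add_le (e.source.1 - (v.1 + t * α)) x,
      abs_add_le (e.source.2 - (v.2 + t * β)) y]

theorem norm_mul_one_add_le_of_near_axis {E : Type*} [NormedAddCommGroup E] [InnerProductSpace ℝ E]
    {v z : E} {s κ C : ℝ} (hv : ‖v‖ = 1) (hs : 0 ≤ s) (hz : ‖z‖ * κ ≤ ⟪v, z⟫_ℝ)
    (hC : ‖z + s • v‖ ≤ C) : ‖z‖ * (1 + κ) ≤ 2 * C := by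
  have hinner : ⟪v, z⟫_ℝ + s ≤ C := by
    have := (real_inner_le_norm v (z + s • v)).trans_eq (by rw [hv, one_mul])
    rw [inner_add_right, inner_smul_right, real_inner_self_eq_norm_sq, hv] at this
    linarith
  have hnorm : ‖z‖ ≤ C + s := by
    have := norm_sub_le (z + s • v) (s • v)
    rw [add_sub_cancel_right, norm_smul, hv, Real.norm_of_nonneg hs] at this
    linarith
  linarith

theorem IsCone.exists_axis {Λ : Set Plane} (hΛ : IsCone Λ) : ∃ (a v : Plane) (κ : ℝ), ‖v‖ = 1 ∧
    -1 < κ ∧ ∀ x ∈ Λ, ‖x - a‖ * κ ≤ ⟪v, x - a⟫_ℝ := by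
  obtain ⟨a, v, θ, hv, hθ0, hθ, hcone⟩ := hΛ
  refine ⟨a, v, Real.cos (θ / 2), hv, ?_, fun x hx => ?_⟩
  · rw [← Real.cos_pi]
    exact Real.cos_lt_cos_of_nonneg_of_le_pi (by linarith) le_rfl (by linarith)
  · rcases hcone with rfl | rfl
    exacts [le_of_lt hx, hx]

/-- The ray from `v` in the direction opposite to the cone leaves the cone up to a bounded part. -/
theorem IsCone.eq_zero_of_jumps {Λ : Set Plane} (hΛ : IsCone Λ) :
    ∃ a : Plane, ∀ v : Vertex, ∃ R : ℝ, ∀ w : Vertex →₀ ℤ,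
      (∀ e : Edge, w e.source ≠ w e.target → e.mid ∈ Λ ∧ e.mid ∉ Metric.ball a R) → w v = 0 := by
  obtain ⟨a, u, κ, hu, hκ, hmem⟩ := hΛ.exists_axis
  refine ⟨a, fun v => ⟨2 * (‖v.pos - a‖ + 5) / (1 + κ) + 1, fun w hjump => ?_⟩⟩
  refine eq_zero_of_const_along_ray (u := -u) (by rw [norm_neg, hu]) fun s e hs he => ?_
  by_contra hne
  obtain ⟨hin, hout⟩ := hjump e hne
  have hnear : ‖e.mid - a + s • u‖ ≤ ‖v.pos - a‖ + 5 := by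
    have hsplit : e.mid - a + s • u = (v.pos - a) + (e.mid - (v.pos + s • -u)) := by
      rw [smul_neg]; abel
    exact hsplit ▸ (norm_add_le _ _).trans (by gcongr)
  have hbound := (le_div_iff₀ (by linarith)).2
    (norm_mul_one_add_le_of_near_axis hu hs (hmem _ hin) hnear)
  rw [mem_ball_iff_norm] at hout
  linarith

/-! ## Ribbon operators in the basis of configurations -/

section RibbonOperators

variable {G : Type*} [Group G]

namespace Config

/-- The parallel transport along a triangle: a direct triangle reads off its edge in the direction
of travel, a dual triangle stays at its vertex. -/
def transport (c : Config G) : Triangle → G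
  | .direct s₀ _ e _ _ => if s₀.vertex = e.source then c.1 e else (c.1 e)⁻¹
  | .dual _ _ _ _ _ => 1

/-- The parallel transport along a list of triangles. -/
def holonomy (c : Config G) (ρ : List Triangle) : G := (ρ.map c.transport).prod

/-- The effect of `L_τ^h` on a configuration; a direct triangle has none. -/
def push (c : Config G) : Triangle → G → Config G
  | .direct _ _ _ _ _, _ => c
  | .dual s₀ _ e _ _, h =>
      c.set e (if s₀.vertex = e.source then (if s₀.face = e.right then h else h⁻¹) * c.1 e
        else c.1 e * (if s₀.face = e.right then h else h⁻¹))

/-- The effect of the ribbon operators `F_ρ^{h,g}` on the configurations they do not annihilate. -/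
def pushAlong (c : Config G) : List Triangle → G → Config G
  | [], _ => c
  | τ :: ρ, h => (c.pushAlong ρ ((c.transport τ)⁻¹ * h * c.transport τ)).push τ h

@[simp] theorem holonomy_nil (c : Config G) : c.holonomy [] = 1 := rfl

@[simp] theorem holonomy_cons (c : Config G) (τ : Triangle) (ρ : List Triangle) :
    c.holonomy (τ :: ρ) = c.transport τ * c.holonomy ρ := by simp [holonomy]

theorem transport_congr {c c' : Config G} {τ : Triangle} (h : c.1 τ.edge = c'.1 τ.edge) :
    c.transport τ = c'.transport τ := by
  cases τ with
  | direct _ _ e =>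
    have h : c.1 e = c'.1 e := h
    simp only [transport, h]
  | dual => rfl

theorem push_apply_of_ne (c : Config G) {τ : Triangle} {e : Edge} (he : τ.edge ≠ e) (h : G) :
    (c.push τ h).1 e = c.1 e := by
  cases τ with
  | direct => rfl
  | dual => exact (set_apply ..).trans (if_neg (Ne.symm he))

theorem pushAlong_apply_of_notMem (c : Config G) {ρ : List Triangle} {e : Edge}
    (he : e ∉ ρ.map Triangle.edge) (h : G) : (c.pushAlong ρ h).1 e = c.1 e := by
  induction ρ generalizing h with
  | nil => rfl
  | cons τ ρ ih =>
    rw [List.map_cons, List.mem_cons, not_or] at he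
    rw [pushAlong, push_apply_of_ne _ (Ne.symm he.1), ih he.2]

/-- `k` is a potential of `c` on the edge `e`. -/
def IsPotentialAt (c : Config G) (k : Vertex → G) (e : Edge) : Prop :=
  c.1 e = (k e.source)⁻¹ * k e.target

theorem IsPotentialAt.transport_eq {c : Config G} {k : Vertex → G} {τ : Triangle}
    (hk : c.IsPotentialAt k τ.edge) :
    c.transport τ = (k τ.first.vertex)⁻¹ * k τ.final.vertex := by
  cases τ with
  | direct s₀ s₁ e hf he =>
    replace hk : c.1 e = (k e.source)⁻¹ * k e.target := hk
    rcases he with ⟨h0, h1⟩ | ⟨h0, h1⟩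
    · simp [transport, Triangle.first, Triangle.final, h0, h1, hk]
    · simp [transport, Triangle.first, Triangle.final, h0, h1, hk, e.source_ne_target.symm]
  | dual s₀ s₁ e hv he => simp [transport, Triangle.first, Triangle.final, hv]

theorem holonomy_eq_of_isPotentialAt {c : Config G} {k : Vertex → G} {s s' : Site}
    {ρ : List Triangle} (hp : IsPath s ρ s') (hk : ∀ τ ∈ ρ, c.IsPotentialAt k τ.edge) :
    c.holonomy ρ = (k s.vertex)⁻¹ * k s'.vertex := by
  induction ρ generalizing s with
  | nil => rw [show s = s' from hp, holonomy_nil, inv_mul_cancel]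
  | cons τ ρ ih =>
    obtain ⟨rfl, hp⟩ := hp
    rw [List.forall_mem_cons] at hk
    rw [holonomy_cons, hk.1.transport_eq, ih hp hk.2]
    group

end Config

theorem Edge.eq_source_or_target {e : Edge} {v : Vertex} (h : v ∈ e.left.corners)
    (h' : v ∈ e.right.corners) : v = e.source ∨ v = e.target := by
  rcases e with ⟨⟨a, b⟩, d⟩
  rcases v with ⟨x, y⟩
  fin_cases d <;> simp [Edge.left, Edge.right, Edge.target, Face.corners] at h h' ⊢ <;> omega

theorem Edge.eq_source_or_target_of_dual {e : Edge} {s₀ s₁ : Site} (hv : s₀.vertex = s₁.vertex)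
    (he : (s₀.face = e.right ∧ s₁.face = e.left) ∨ (s₀.face = e.left ∧ s₁.face = e.right)) :
    s₀.vertex = e.source ∨ s₀.vertex = e.target := by
  rcases he with ⟨h0, h1⟩ | ⟨h0, h1⟩
  · exact e.eq_source_or_target (h1 ▸ hv ▸ s₁.mem) (h0 ▸ s₀.mem)
  · exact e.eq_source_or_target (h0 ▸ s₀.mem) (h1 ▸ hv ▸ s₁.mem)

namespace Config

theorem push_apply_of_eq {c : Config G} {k : Vertex → G} {τ : Triangle} {e : Edge} {h : G} {z : ℤ}
    (hc : c.1 e = (k e.source)⁻¹ * (k τ.first.vertex * h * (k τ.first.vertex)⁻¹) ^ z * k e.target) :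
    (c.push τ h).1 e = (k e.source)⁻¹ *
      (k τ.first.vertex * h * (k τ.first.vertex)⁻¹) ^ (crossing τ e + z) * k e.target := by
  by_cases he : τ.edge = e
  · cases τ with
    | direct => rwa [crossing, Finsupp.zero_apply, zero_add]
    | dual s₀ s₁ e' hv hf =>
      obtain rfl : e' = e := he
      simp only [push, crossing, Triangle.first, set_apply, if_true, Finsupp.single_eq_same] at hc ⊢
      rw [hc]
      rcases Edge.eq_source_or_target_of_dual hv hf with h0 | h0
      · rw [if_pos h0, zpow_add, h0]
        split_ifs <;> simp [mul_assoc]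
      · rw [if_neg (h0 ▸ e'.source_ne_target.symm), add_comm, zpow_add, h0]
        split_ifs <;> simp [mul_assoc]
  · rwa [push_apply_of_ne _ he, crossing_apply_eq_zero he, zero_add]

theorem pushAlong_apply {c : Config G} {k : Vertex → G} {s s' : Site} {ρ : List Triangle}
    (hp : IsPath s ρ s') (hk : ∀ τ ∈ ρ, c.IsPotentialAt k τ.edge) {e : Edge}
    (he : c.IsPotentialAt k e) (h : G) : (c.pushAlong ρ h).1 e =
      (k e.source)⁻¹ * (k s.vertex * h * (k s.vertex)⁻¹) ^ crossings ρ e * k e.target := by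
  induction ρ generalizing s h with
  | nil => rw [pushAlong, crossings_nil, Finsupp.zero_apply, zpow_zero, mul_one]; exact he
  | cons τ ρ ih =>
    obtain ⟨rfl, hp⟩ := hp
    rw [List.forall_mem_cons] at hk
    refine push_apply_of_eq ?_
    rw [ih hp hk.2, hk.1.transport_eq]
    congr 3
    group

end Config

variable [DecidableEq G]

theorem actOn_directOp_ket (s₀ s₁ : Site) (e : Edge) (hf he) (g : G) (c : Config G) :
    actOn (directOp s₀ e g) (ket c) =
      if c.transport (.direct s₀ s₁ e hf he) = g then ket c else 0 := by
  simp only [directOp, Config.transport, apply_ite (actOn · (ket c)), actOn_edgeT_ket]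
  by_cases h : s₀.vertex = e.source
  · simp only [if_pos h]
  · simp only [if_neg h, inv_eq_iff_eq_inv]

variable [Fintype G]

theorem actOn_dualOp_ket (s₀ s₁ : Site) (e : Edge) (hv he) (h : G) (c : Config G) :
    actOn (dualOp s₀ e h) (ket c) = ket (c.push (.dual s₀ s₁ e hv he) h) := by
  simp only [dualOp, Config.push]
  split_ifs <;> simp [actOn_edgeL_ket, actOn_edgeR_ket]

theorem actOn_triangleOp_ket (τ : Triangle) (h g : G) (c : Config G) :
    actOn (triangleOp τ h g) (ket c) = if c.transport τ = g then ket (c.push τ h) else 0 := by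
  cases τ with
  | direct s₀ s₁ e hf he => rw [triangleOp_direct, actOn_directOp_ket, Config.push]
  | dual s₀ s₁ e hv he =>
    rw [triangleOp_dual, apply_ite (actOn · (ket c)), actOn_dualOp_ket s₀ s₁ e hv he, actOn_zero]
    exact if_congr eq_comm rfl rfl

theorem actOn_ribbonOp_ket {ρ : List Triangle} (hρ : (ρ.map Triangle.edge).Nodup) (h g : G)
    (c : Config G) :
    actOn (ribbonOp ρ h g) (ket c) = if c.holonomy ρ = g then ket (c.pushAlong ρ h) else 0 := by
  induction ρ generalizing h g with
  | nil =>
    rw [ribbonOp, apply_ite (actOn · (ket c)), actOn_one, actOn_zero]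
    exact if_congr eq_comm rfl rfl
  | cons τ ρ ih =>
    rw [List.map_cons, List.nodup_cons] at hρ
    have hstep : ∀ k, actOn (triangleOp τ h k * ribbonOp ρ (k⁻¹ * h * k) (k⁻¹ * g)) (ket c) =
        if c.transport τ = k then
          (if c.holonomy (τ :: ρ) = g then ket (c.pushAlong (τ :: ρ) h) else 0) else 0 := by
      intro k
      have htransport : (c.pushAlong ρ (k⁻¹ * h * k)).transport τ = c.transport τ :=
        Config.transport_congr (c.pushAlong_apply_of_notMem hρ.1 _)
      rw [actOn_mul, ih hρ.2, apply_ite (actOn _), actOn_vec_zero, actOn_triangleOp_ket,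
        htransport]
      by_cases hk : c.transport τ = k
      · subst hk
        rw [if_pos rfl, if_pos rfl]
        exact if_congr eq_inv_mul_iff_mul_eq rfl rfl
      · rw [if_neg hk, if_neg hk, ite_self]
    simp only [ribbonOp, actOn_sum, hstep, Finset.sum_ite_eq, Finset.mem_univ, if_true]

end RibbonOperators

/-! ## Gauge transformations and flat configurations -/

section GaugeTransformations

variable {G : Type*} [Group G]

/-- The configuration `c'` is the gauge transform of `c` by `x`. -/
def IsGaugeTransform (x : Vertex → G) (c c' : Config G) : Prop :=
  ∀ e, c'.1 e = x e.source * c.1 e * (x e.target)⁻¹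

theorem IsGaugeTransform.comp {x y : Vertex → G} {c c' c'' : Config G}
    (hy : IsGaugeTransform y c' c'') (hx : IsGaugeTransform x c c') :
    IsGaugeTransform (y * x) c c'' := fun e => by
  rw [hy, hx, Pi.mul_apply, Pi.mul_apply]
  group

theorem IsGaugeTransform.unique {x : Vertex → G} {c c' c'' : Config G}
    (h' : IsGaugeTransform x c c') (h'' : IsGaugeTransform x c c'') : c' = c'' :=
  Config.ext fun e => (h' e).trans (h'' e).symm

theorem IsGaugeTransform.symm {x : Vertex → G} {c c' : Config G} (h : IsGaugeTransform x c c') :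
    IsGaugeTransform x⁻¹ c' c := fun e => by
  rw [h, Pi.inv_apply, Pi.inv_apply]
  group

theorem IsGaugeTransform.isPotentialAt {x k : Vertex → G} {c c' : Config G} {e : Edge}
    (h : IsGaugeTransform x c c') (hk : c.IsPotentialAt k e) :
    c'.IsPotentialAt (k * x⁻¹) e := by
  rw [Config.IsPotentialAt, h, hk]
  simp only [Pi.mul_apply, Pi.inv_apply]
  group

theorem nodup_edge_starRibbon (a b : ℤ) : ((starRibbon a b).map Triangle.edge).Nodup := by
  simp only [starRibbon, Triangle.edge, List.map_cons, List.map_nil, List.nodup_cons,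
    List.mem_cons, Edge.mk.injEq, Prod.mk.injEq]
  simp
  omega

theorem nodup_edge_plaquetteRibbon (f : Face) :
    ((plaquetteRibbon f).map Triangle.edge).Nodup := by
  cases f <;> simp [plaquetteRibbon, Triangle.edge]

theorem isGaugeTransform_pushAlong_starRibbon (v : Vertex) (h : G) (c : Config G) :
    IsGaugeTransform (Pi.mulSingle v h) c (c.pushAlong (starRibbon v.1 v.2) h) := by
  rcases v with ⟨a, b⟩
  rcases c with ⟨u, hu⟩
  rintro ⟨⟨x, y⟩, d⟩
  fin_cases d <;>
    simp [starRibbon, Config.pushAlong, Config.push, Config.transport, Config.set_apply,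
      Edge.target, Edge.right, Pi.mulSingle_apply, apply_ite Inv.inv] <;>
    grind

/-- The configuration `c` has trivial flux through the face `f`. -/
def Config.FlatAt (c : Config G) (f : Face) : Prop := c.holonomy (plaquetteRibbon f) = 1

theorem Config.pushAlong_plaquetteRibbon (c : Config G) (f : Face) (h : G) :
    c.pushAlong (plaquetteRibbon f) h = c := by cases f <;> rfl

theorem Config.flatAt_up_iff {c : Config G} {a b : ℤ} :
    c.FlatAt (.up a b) ↔ c.1 ⟨(a, b), 0⟩ = c.1 ⟨(a, b), 1⟩ * c.1 ⟨(a, b + 1), 2⟩ := by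
  simp [FlatAt, plaquetteRibbon, transport, ← mul_inv_rev, mul_inv_eq_one]

theorem Config.flatAt_down_iff {c : Config G} {a b : ℤ} :
    c.FlatAt (.down a b) ↔ c.1 ⟨(a, b + 1), 0⟩ = c.1 ⟨(a, b + 1), 2⟩ * c.1 ⟨(a + 1, b), 1⟩ := by
  simp only [FlatAt, plaquetteRibbon, holonomy_cons, transport, holonomy_nil, mul_one]
  have hne : (a + 1, b + 1) ≠ (a, b + 1) := by simp
  simp only [if_true, hne, if_false]
  rw [mul_eq_one_iff_eq_inv', inv_mul_eq_iff_eq_mul, eq_mul_inv_iff_mul_eq, eq_comm]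

theorem exists_multiplicative_primitive (f : ℤ → G) :
    ∃ F : ℤ → G, F 0 = 1 ∧ ∀ x, F (x + 1) = F x * f x := by
  refine ⟨fun x => Int.rec (fun n => Nat.rec 1 (fun m r => r * f m) n)
    (fun n => Nat.rec (f (-1))⁻¹ (fun m r => r * (f (-(m + 2)))⁻¹) n) x, rfl, ?_⟩
  rintro (n | _ | n)
  · rfl
  · exact (inv_mul_cancel _).symm
  · exact (inv_mul_cancel_right _ _).symm

theorem exists_potential_of_commuting_squares {A B : ℤ → ℤ → G} {M : ℤ}
    (hAB : ∀ x y, |x| ≤ M → |y| ≤ M → A x y * B (x + 1) y = B x y * A x (y + 1)) :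
    ∃ K : ℤ → ℤ → G, (∀ x y, |x| ≤ M → |y| ≤ M → K (x + 1) y = K x y * A x y) ∧
      ∀ x y, K x (y + 1) = K x y * B x y := by
  obtain ⟨R, -, hR⟩ := exists_multiplicative_primitive fun x => A x 0
  choose C hC0 hC using fun x => exists_multiplicative_primitive (B x)
  have hstep : ∀ x y, |x| ≤ M → |y| ≤ M → (R (x + 1) * C (x + 1) y = R x * C x y * A x y ↔
      R (x + 1) * C (x + 1) (y + 1) = R x * C x (y + 1) * A x (y + 1)) := by
    intro x y hx hy
    rw [hC, hC, ← mul_assoc, ← mul_assoc, mul_assoc _ (B x y), ← hAB x y hx hy, ← mul_assoc,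
      mul_left_inj]
  simp only [abs_le] at hAB hstep ⊢
  refine ⟨fun x y => R x * C x y, fun x y hx hy => ?_, fun x y => ?_⟩
  · beta_reduce
    induction y using Int.induction_on with
    | zero => rw [hC0, hC0, hR, mul_one, mul_one]
    | succ y ih => exact (hstep x y hx (by omega)).1 (ih (by omega))
    | pred y ih =>
      refine (hstep x _ hx hy).2 ?_
      rw [sub_add_cancel]
      exact ih (by omega)
  · beta_reduce
    rw [hC, mul_assoc]

theorem Config.exists_potential_of_finite (G : Type*) [Group G] {E : Set Edge} (hE : E.Finite) :
    ∃ l : List Face, ∀ c : Config G, (∀ f ∈ l, c.FlatAt f) →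
      ∃ k : Vertex → G, ∀ e ∈ E, c.IsPotentialAt k e := by
  obtain ⟨M, hM⟩ : ∃ M : ℤ, ∀ e ∈ E, |e.source.1| < M ∧ |e.source.2| < M := by
    obtain ⟨M, hM⟩ := (hE.image fun e => max |e.source.1| |e.source.2|).bddAbove
    refine ⟨M + 1, fun e he => ?_⟩
    have := hM (Set.mem_image_of_mem _ he)
    grind
  refine ⟨(Finset.Icc (-M) M ×ˢ Finset.Icc (-M) M).toList.flatMap fun v =>
    [.up v.1 v.2, .down v.1 v.2], fun c hc => ?_⟩
  have hflat : ∀ x y, |x| ≤ M → |y| ≤ M → c.FlatAt (.up x y) ∧ c.FlatAt (.down x y) := by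
    intro x y hx hy
    rw [abs_le] at hx hy
    constructor <;> refine hc _ (List.mem_flatMap.2 ⟨(x, y), ?_, ?_⟩) <;> simp [hx, hy]
  obtain ⟨K, hK0, hK1⟩ := exists_potential_of_commuting_squares
    (A := fun x y => c.1 ⟨(x, y), 0⟩) (B := fun x y => c.1 ⟨(x, y), 1⟩) (M := M)
    fun x y hx hy => by
      rw [flatAt_up_iff.1 (hflat x y hx hy).1, flatAt_down_iff.1 (hflat x y hx hy).2, mul_assoc]
  refine ⟨fun v => K v.1 v.2, ?_⟩
  rintro ⟨⟨x, y⟩, d⟩ he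
  obtain ⟨hx, hy⟩ := hM _ he
  refine eq_inv_mul_of_mul_eq ?_
  fin_cases d
  · exact (hK0 x y hx.le hy.le).symm
  · exact (hK1 x y).symm
  · have hy' : |y - 1| ≤ M := by grind
    have hup := flatAt_up_iff.1 (hflat x (y - 1) hx.le hy').1
    have hcol := hK1 x (y - 1)
    rw [sub_add_cancel] at hup hcol
    exact (hcol ▸ (hK0 x (y - 1) hx.le hy').trans (hup ▸ (mul_assoc _ _ _).symm)).symm

end GaugeTransformations

/-! ## Deformation of ribbons in the ground state -/

theorem isStarProjection_average {A G : Type*} [Ring A] [StarRing A] [Algebra ℂ A] [StarModule ℂ A]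
    [Group G] [Fintype G] {U : G → A} (hmul : ∀ g h, U g * U h = U (g * h))
    (hstar : ∀ g, star (U g) = U g⁻¹) :
    IsStarProjection ((Fintype.card G : ℂ)⁻¹ • ∑ g, U g) := by
  have hcard : (Fintype.card G : ℂ) ≠ 0 := Nat.cast_ne_zero.2 Fintype.card_ne_zero
  refine ⟨?_, ?_⟩
  · have habsorb : ∀ g, U g * ∑ h, U h = ∑ h, U h := fun g => by
      rw [Finset.mul_sum]
      exact Fintype.sum_equiv (Equiv.mulLeft g) _ _ fun h => hmul g h
    rw [IsIdempotentElem, smul_mul_smul_comm, Finset.sum_mul]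
    simp only [habsorb, Finset.sum_const, Finset.card_univ]
    rw [← Nat.cast_smul_eq_nsmul ℂ, smul_smul, mul_assoc, inv_mul_cancel₀ hcard, mul_one]
  · rw [IsSelfAdjoint, star_smul, star_sum, star_inv₀, star_natCast]
    simp only [hstar]
    exact congrArg _ (Equiv.sum_comp (Equiv.inv G) U)

section Fixed

variable {G : Type*} [Group G] [DecidableEq G]
  {H : Type*} [NormedAddCommGroup H] [InnerProductSpace ℂ H] [CompleteSpace H]
  {ω₀ : quasiLocal G →ₗ[ℂ] ℂ} {π₀ : quasiLocal G →⋆ₐ[ℂ] (H →L[ℂ] H)} {Ω : H}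

theorem IsGNSTriple.apply_eq_self_of_isStarProjection (hGNS : IsGNSTriple ω₀ π₀ Ω)
    {p : quasiLocal G} (hp : IsStarProjection p) (h : ω₀ p = ω₀ 1) : π₀ p Ω = Ω := by
  have hq : star (1 - p) * (1 - p) = 1 - p := by
    rw [hp.one_sub.isSelfAdjoint.star_eq, hp.one_sub.isIdempotentElem.eq]
  have hinner : ⟪π₀ (1 - p) Ω, π₀ (1 - p) Ω⟫_ℂ = 0 := by
    rw [← ContinuousLinearMap.adjoint_inner_right, ← ContinuousLinearMap.star_eq_adjoint,
      ← map_star, ← mul_apply_eq_comp, ← map_mul, hq, ← hGNS.vector_state, map_sub, h, sub_self]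
  rw [inner_self_eq_zero, map_sub, map_one, sub_apply, one_apply_eq_self, sub_eq_zero] at hinner
  exact hinner.symm

theorem map_list_prod_apply_eq_self {l : List (quasiLocal G)} (h : ∀ a ∈ l, π₀ a Ω = Ω) :
    π₀ l.prod Ω = Ω := by
  induction l with
  | nil => rw [List.prod_nil, map_one, one_apply_eq_self]
  | cons a l ih =>
    rw [List.forall_mem_cons] at h
    rw [List.prod_cons, map_mul, mul_apply_eq_comp, ih h.2, h.1]

end Fixed

section GaugeOperators

variable {G : Type*} [Group G] [Fintype G] [DecidableEq G]

/-- The operator `A_v^h` of the gauge transformation by `h` at the vertex `v`. -/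
noncomputable def gaugeAt (v : Vertex) (h : G) : quasiLocal G := ribbonOp (starRibbon v.1 v.2) h 1

theorem exists_actOn_gaugeAt_ket (v : Vertex) (h : G) (c : Config G) :
    ∃ c', IsGaugeTransform (Pi.mulSingle v h) c c' ∧ actOn (gaugeAt v h) (ket c) = ket c' := by
  refine ⟨_, isGaugeTransform_pushAlong_starRibbon v h c, ?_⟩
  rw [gaugeAt, actOn_ribbonOp_ket (nodup_edge_starRibbon ..), if_pos]
  simp [starRibbon, Config.transport]

theorem gaugeAt_mul (v : Vertex) (g h : G) : gaugeAt v g * gaugeAt v h = gaugeAt v (g * h) := by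
  refine quasiLocal_ext_ket fun c => ?_
  obtain ⟨c₁, hc₁, hket₁⟩ := exists_actOn_gaugeAt_ket v h c
  obtain ⟨c₂, hc₂, hket₂⟩ := exists_actOn_gaugeAt_ket v g c₁
  obtain ⟨c₃, hc₃, hket₃⟩ := exists_actOn_gaugeAt_ket v (g * h) c
  rw [Pi.mulSingle_mul] at hc₃
  rw [actOn_mul, hket₁, hket₂, hket₃, (hc₂.comp hc₁).unique hc₃]

theorem star_gaugeAt (v : Vertex) (h : G) : star (gaugeAt v h) = gaugeAt v h⁻¹ := by
  refine Subtype.ext (star_eq_of_inner_ket fun c c' => ?_)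
  obtain ⟨c₁, hc₁, hket₁⟩ := exists_actOn_gaugeAt_ket v h c
  obtain ⟨c₂, hc₂, hket₂⟩ := exists_actOn_gaugeAt_ket v h⁻¹ c'
  have hiff : c₁ = c' ↔ c = c₂ := by
    rw [Pi.mulSingle_inv] at hc₂
    refine ⟨?_, ?_⟩
    · rintro rfl
      exact hc₁.symm.unique hc₂
    · rintro rfl
      exact hc₁.unique (inv_inv (Pi.mulSingle v h : Vertex → G) ▸ hc₂.symm)
  change ⟪actOn (gaugeAt v h) (ket c), ket c'⟫_ℂ = ⟪ket c, actOn (gaugeAt v h⁻¹) (ket c')⟫_ℂ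
  rw [hket₁, hket₂, inner_ket_left, inner_ket_left, ket_apply, ket_apply]
  classical exact if_congr hiff rfl rfl

theorem isStarProjection_starOp (v : Vertex) : IsStarProjection (starOp G v) :=
  isStarProjection_average (gaugeAt_mul v) (star_gaugeAt v)

theorem gaugeAt_mul_starOp (v : Vertex) (h : G) : gaugeAt v h * starOp G v = starOp G v := by
  rw [starOp, mul_smul_comm, Finset.mul_sum]
  exact congrArg _ (Fintype.sum_equiv (Equiv.mulLeft h) _ _ fun g => gaugeAt_mul v h g)

/-- The product of the gauge transformations by `x` at the vertices of a list. -/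
noncomputable def gaugeList (x : Vertex → G) (l : List Vertex) : quasiLocal G :=
  (l.map fun v => gaugeAt v (x v)).prod

theorem exists_actOn_gaugeList_ket (x : Vertex → G) {l : List Vertex} (hl : l.Nodup)
    (c : Config G) : ∃ c', IsGaugeTransform (fun v => if v ∈ l then x v else 1) c c' ∧
      actOn (gaugeList x l) (ket c) = ket c' := by
  induction l with
  | nil => exact ⟨c, fun e => by simp, rfl⟩
  | cons v l ih =>
    rw [List.nodup_cons] at hl
    obtain ⟨c₁, hc₁, hket₁⟩ := ih hl.2
    obtain ⟨c₂, hc₂, hket₂⟩ := exists_actOn_gaugeAt_ket v (x v) c₁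
    have hsplit : (fun u => if u ∈ v :: l then x u else 1) =
        Pi.mulSingle v (x v) * fun u => if u ∈ l then x u else 1 := by
      ext u
      by_cases hu : u = v
      · simp [hu, hl.1]
      · simp [hu]
    refine ⟨c₂, hsplit ▸ hc₂.comp hc₁, ?_⟩
    rw [gaugeList, List.map_cons, List.prod_cons, actOn_mul, ← gaugeList, hket₁, hket₂]

instance (c : Config G) : DecidablePred c.FlatAt := fun f =>
  inferInstanceAs (Decidable (c.holonomy (plaquetteRibbon f) = 1))

theorem actOn_plaquetteOp_ket (f : Face) (c : Config G) :
    actOn (plaquetteOp G f) (ket c) = if c.FlatAt f then ket c else 0 := by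
  rw [plaquetteOp, actOn_ribbonOp_ket (nodup_edge_plaquetteRibbon f),
    Config.pushAlong_plaquetteRibbon]
  rfl

theorem isStarProjection_plaquetteOp (f : Face) : IsStarProjection (plaquetteOp G f) := by
  refine ⟨quasiLocal_ext_ket fun c => ?_, Subtype.ext (star_eq_of_inner_ket fun c c' => ?_)⟩
  · rw [actOn_mul, actOn_plaquetteOp_ket]
    split_ifs with hc
    · rw [actOn_plaquetteOp_ket, if_pos hc]
    · exact actOn_vec_zero _
  · change ⟪actOn (plaquetteOp G f) (ket c), ket c'⟫_ℂ = ⟪ket c, actOn (plaquetteOp G f) (ket c')⟫_ℂ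
    simp only [actOn_plaquetteOp_ket]
    by_cases h : c = c'
    · subst h
      split_ifs <;> simp
    · split_ifs <;> simp [inner_ket_left, ket_apply, h]

theorem actOn_plaquetteOp_prod_ket (l : List Face) (c : Config G) :
    actOn (l.map (plaquetteOp G)).prod (ket c) = if ∀ f ∈ l, c.FlatAt f then ket c else 0 := by
  induction l with
  | nil => simp
  | cons f l ih =>
    rw [List.map_cons, List.prod_cons, actOn_mul, ih]
    by_cases hl : ∀ f ∈ l, c.FlatAt f
    · rw [if_pos hl, actOn_plaquetteOp_ket]
      simp [and_iff_left hl]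
    · simp [hl]

end GaugeOperators

section Deformation

variable {G : Type*} [Group G] {ρ ρ' : List Triangle} {s s' : Site} {w : Vertex →₀ ℤ}

theorem IsWinding.pushAlong_eq {c c' : Config G} {k : Vertex → G} {E : Set Edge} {h : G}
    (hw : IsWinding (crossings ρ - crossings ρ') w) (hp : IsPath s ρ s') (hp' : IsPath s ρ' s')
    (hρE : ∀ τ ∈ ρ, τ.edge ∈ E) (hρ'E : ∀ τ ∈ ρ', τ.edge ∈ E)
    (hwE : ∀ e, w e.source ≠ 0 → e ∈ E) (hs : w s.vertex = 0)
    (hk : ∀ e ∈ E, c.IsPotentialAt k e) (hc : IsGaugeTransform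
      (fun v => (k v)⁻¹ * (k s.vertex * h * (k s.vertex)⁻¹) ^ w v * k v) c c') :
    c.pushAlong ρ h = c'.pushAlong ρ' h := by
  refine Config.ext fun e => ?_
  by_cases he : e ∈ E
  · have hk' := fun e he => hc.isPotentialAt (hk e he)
    have hcross : crossings ρ e = w e.source + crossings ρ' e + -w e.target := by
      have := hw e
      rw [Finsupp.sub_apply] at this
      omega
    rw [Config.pushAlong_apply hp (fun τ hτ => hk _ (hρE τ hτ)) (hk e he),
      Config.pushAlong_apply hp' (fun τ hτ => hk' _ (hρ'E τ hτ)) (hk' e he), hcross, zpow_add,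
      zpow_add, zpow_neg]
    simp only [Pi.mul_apply, Pi.inv_apply, hs]
    group
  · have hsource : w e.source = 0 := by_contra fun h0 => he (hwE e h0)
    have hcross : crossings ρ e = 0 := crossings_apply_eq_zero fun τ hτ h0 => he (h0 ▸ hρE τ hτ)
    have hcross' : crossings ρ' e = 0 :=
      crossings_apply_eq_zero fun τ hτ h0 => he (h0 ▸ hρ'E τ hτ)
    have htarget : w e.target = 0 := by
      have := hw e
      rw [Finsupp.sub_apply] at this
      omega
    have hnotMem : ∀ σ : List Triangle, (∀ τ ∈ σ, τ.edge ∈ E) → e ∉ σ.map Triangle.edge := by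
      rintro σ hσ hmem
      obtain ⟨τ, hτ, rfl⟩ := List.mem_map.1 hmem
      exact he (hσ τ hτ)
    rw [Config.pushAlong_apply_of_notMem _ (hnotMem ρ hρE),
      Config.pushAlong_apply_of_notMem _ (hnotMem ρ' hρ'E), hc]
    simp [hsource, htarget]

variable [Fintype G] [DecidableEq G]

theorem IsWinding.actOn_ribbonOp_ket_eq {c c' : Config G} {k : Vertex → G} {E : Set Edge} {h : G}
    (hw : IsWinding (crossings ρ - crossings ρ') w) (hp : IsPath s ρ s') (hp' : IsPath s ρ' s')
    (hρ : (ρ.map Triangle.edge).Nodup) (hρ' : (ρ'.map Triangle.edge).Nodup)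
    (hρE : ∀ τ ∈ ρ, τ.edge ∈ E) (hρ'E : ∀ τ ∈ ρ', τ.edge ∈ E)
    (hwE : ∀ e, w e.source ≠ 0 → e ∈ E) (hs : w s.vertex = 0) (hs' : w s'.vertex = 0)
    (hk : ∀ e ∈ E, c.IsPotentialAt k e) (hc : IsGaugeTransform
      (fun v => (k v)⁻¹ * (k s.vertex * h * (k s.vertex)⁻¹) ^ w v * k v) c c') (g : G) :
    actOn (ribbonOp ρ h g) (ket c) = actOn (ribbonOp ρ' h g) (ket c') := by
  have hholonomy : c.holonomy ρ = c'.holonomy ρ' := by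
    rw [Config.holonomy_eq_of_isPotentialAt hp fun τ hτ => hk _ (hρE τ hτ),
      Config.holonomy_eq_of_isPotentialAt hp' fun τ hτ => hc.isPotentialAt (hk _ (hρ'E τ hτ))]
    simp [hs, hs']
  rw [actOn_ribbonOp_ket hρ, actOn_ribbonOp_ket hρ', hholonomy,
    hw.pushAlong_eq hp hp' hρE hρ'E hwE hs hk hc]

/-- The sum of all gauge transformations at the vertices of a finite set. Up to normalisation, it
projects onto the vectors which are invariant under them. -/
noncomputable def gaugeSum (G : Type*) [Group G] [Fintype G] [DecidableEq G] (S : Finset Vertex) :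
    quasiLocal G :=
  ∑ x : S → G, gaugeList (Function.extend Subtype.val x 1) S.toList

theorem exists_actOn_gaugeList_extend_ket {S : Finset Vertex} (x : S → G) (c : Config G) :
    ∃ c', IsGaugeTransform (Function.extend Subtype.val x 1) c c' ∧
      actOn (gaugeList (Function.extend Subtype.val x 1) S.toList) (ket c) = ket c' := by
  convert exists_actOn_gaugeList_ket (Function.extend Subtype.val x 1) S.nodup_toList c using 5
  split_ifs with hv
  · rfl
  · exact Function.extend_apply' _ _ _ fun ⟨u, hu⟩ => hv (Finset.mem_toList.2 (hu ▸ u.2))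

theorem IsWinding.actOn_ribbonOp_gaugeSum_ket_eq {c : Config G} {k : Vertex → G} {E : Set Edge}
    (hw : IsWinding (crossings ρ - crossings ρ') w) (hp : IsPath s ρ s') (hp' : IsPath s ρ' s')
    (hρ : (ρ.map Triangle.edge).Nodup) (hρ' : (ρ'.map Triangle.edge).Nodup)
    (hρE : ∀ τ ∈ ρ, τ.edge ∈ E) (hρ'E : ∀ τ ∈ ρ', τ.edge ∈ E)
    (hwE : ∀ e, w e.source ≠ 0 → e ∈ E) (hs : w s.vertex = 0) (hs' : w s'.vertex = 0)
    (hk : ∀ e ∈ E, c.IsPotentialAt k e) (h g : G) :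
    actOn (ribbonOp ρ h g) (actOn (gaugeSum G w.support) (ket c)) =
      actOn (ribbonOp ρ' h g) (actOn (gaugeSum G w.support) (ket c)) := by
  choose cx hcx hket using fun x : w.support → G => exists_actOn_gaugeList_extend_ket x c
  rw [gaugeSum, actOn_sum, actOn_vec_sum, actOn_vec_sum]
  simp only [hket]
  have hone : ∀ (x : w.support → G) (v : Vertex), w v = 0 →
      Function.extend Subtype.val x 1 v = 1 := fun x v hv =>
    Function.extend_apply' _ _ _ fun ⟨u, hu⟩ => Finsupp.mem_support_iff.1 u.2 (hu ▸ hv)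
  set z : Vertex → G := fun v => (k v)⁻¹ * (k s.vertex * h * (k s.vertex)⁻¹) ^ w v * k v with hz
  have hextend : Function.extend Subtype.val (fun v : w.support => z v) 1 = z := by
    ext v
    by_cases hv : w v = 0
    · rw [hone _ v hv, hz]
      simp [hv]
    · exact Subtype.val_injective.extend_apply _ _ (⟨v, Finsupp.mem_support_iff.2 hv⟩ : w.support)
  -- The shift by `z` turns the effect of `ρ'` into that of `ρ`.
  refine Fintype.sum_equiv (Equiv.mulRight fun v : w.support => z v) _ _ fun x => ?_
  refine hw.actOn_ribbonOp_ket_eq hp hp' hρ hρ' hρE hρ'E hwE hs hs'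
    (fun e he => (hcx x).isPotentialAt (hk e he)) ?_ g
  convert (hcx _).comp (hcx x).symm using 1
  ext v
  rw [Equiv.coe_mulRight, ← mul_one (1 : Vertex → G), Function.extend_mul, hextend, mul_one, hz]
  simp only [Pi.mul_apply, Pi.inv_apply, hone x _ hs]
  group

theorem IsWinding.exists_ribbonOp_mul_eq (hw : IsWinding (crossings ρ - crossings ρ') w)
    (hp : IsPath s ρ s') (hp' : IsPath s ρ' s') (hρ : (ρ.map Triangle.edge).Nodup)
    (hρ' : (ρ'.map Triangle.edge).Nodup) (hs : w s.vertex = 0) (hs' : w s'.vertex = 0) :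
    ∃ l : List Face, ∀ h g : G,
      ribbonOp ρ h g * (gaugeSum G w.support * (l.map (plaquetteOp G)).prod) =
        ribbonOp ρ' h g * (gaugeSum G w.support * (l.map (plaquetteOp G)).prod) := by
  set E : Set Edge := {e | e.source ∈ w.support} ∪ {e | e ∈ (ρ ++ ρ').map Triangle.edge}
  have hE : E.Finite := (finite_edge_source_mem w.support.finite_toSet).union (List.finite_toSet _)
  obtain ⟨l, hl⟩ := Config.exists_potential_of_finite G hE
  refine ⟨l, fun h g => quasiLocal_ext_ket fun c => ?_⟩
  simp only [actOn_mul, actOn_plaquetteOp_prod_ket]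
  split_ifs with hc
  · obtain ⟨k, hk⟩ := hl c hc
    have hρE : ∀ τ ∈ ρ ++ ρ', τ.edge ∈ E := fun τ hτ => .inr (List.mem_map_of_mem hτ)
    rw [List.forall_mem_append] at hρE
    exact hw.actOn_ribbonOp_gaugeSum_ket_eq hp hp' hρ hρ' hρE.1 hρE.2
      (fun e he => .inl (Finsupp.mem_support_iff.2 he)) hs hs' hk h g
  · simp only [actOn_vec_zero]

variable {H : Type*} [NormedAddCommGroup H] [InnerProductSpace ℂ H] [CompleteSpace H]
  {ω₀ : quasiLocal G →ₗ[ℂ] ℂ} {π₀ : quasiLocal G →⋆ₐ[ℂ] (H →L[ℂ] H)} {Ω : H}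

theorem plaquetteOp_apply_ground_vector (hω₀ : IsFrustrationFreeGroundState ω₀)
    (hGNS : IsGNSTriple ω₀ π₀ Ω) (f : Face) : π₀ (plaquetteOp G f) Ω = Ω :=
  hGNS.apply_eq_self_of_isStarProjection (isStarProjection_plaquetteOp f)
    ((hω₀.plaquette_eq_one f).trans hω₀.map_one.symm)

theorem gaugeAt_apply_ground_vector (hω₀ : IsFrustrationFreeGroundState ω₀)
    (hGNS : IsGNSTriple ω₀ π₀ Ω) (v : Vertex) (h : G) : π₀ (gaugeAt v h) Ω = Ω := by
  have hstar := hGNS.apply_eq_self_of_isStarProjection (isStarProjection_starOp v)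
    ((hω₀.star_eq_one v).trans hω₀.map_one.symm)
  rw [← hstar, ← mul_apply_eq_comp, ← map_mul, gaugeAt_mul_starOp]

theorem gaugeSum_apply_ground_vector (hω₀ : IsFrustrationFreeGroundState ω₀)
    (hGNS : IsGNSTriple ω₀ π₀ Ω) (S : Finset Vertex) :
    π₀ (gaugeSum G S) Ω = (Fintype.card (S → G) : ℂ) • Ω := by
  have hlist : ∀ x : Vertex → G, π₀ (gaugeList x S.toList) Ω = Ω := fun x =>
    map_list_prod_apply_eq_self <| List.forall_mem_map.2 fun v _ =>
      gaugeAt_apply_ground_vector hω₀ hGNS v _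
  rw [gaugeSum, map_sum, sum_apply]
  simp only [hlist, Finset.sum_const, Finset.card_univ, Nat.cast_smul_eq_nsmul]

theorem IsWinding.ribbonOp_apply_ground_vector_eq (hω₀ : IsFrustrationFreeGroundState ω₀)
    (hGNS : IsGNSTriple ω₀ π₀ Ω) (hw : IsWinding (crossings ρ - crossings ρ') w)
    (hp : IsPath s ρ s') (hp' : IsPath s ρ' s') (hρ : (ρ.map Triangle.edge).Nodup)
    (hρ' : (ρ'.map Triangle.edge).Nodup) (hs : w s.vertex = 0) (hs' : w s'.vertex = 0) (h g : G) :
    π₀ (ribbonOp ρ h g) Ω = π₀ (ribbonOp ρ' h g) Ω := by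
  obtain ⟨l, hl⟩ := hw.exists_ribbonOp_mul_eq (G := G) hp hp' hρ hρ' hs hs'
  have hflat : π₀ (l.map (plaquetteOp G)).prod Ω = Ω :=
    map_list_prod_apply_eq_self <| List.forall_mem_map.2 fun f _ =>
      plaquetteOp_apply_ground_vector hω₀ hGNS f
  have heq := congrArg (π₀ · Ω) (hl h g)
  simp only [map_mul, mul_apply_eq_comp, hflat, gaugeSum_apply_ground_vector hω₀ hGNS,
    map_smul] at heq
  exact smul_right_injective H (Nat.cast_ne_zero.2 Fintype.card_ne_zero) heq

end Deformation

/-! ## Bridges -/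

theorem Triangle.opp_opp (τ : Triangle) : τ.opp.opp = τ := by cases τ <;> rfl

theorem Triangle.edge_opp (τ : Triangle) : τ.opp.edge = τ.edge := by cases τ <;> rfl

theorem Triangle.first_opp (τ : Triangle) : τ.opp.first = τ.final := by cases τ <;> rfl

theorem Triangle.final_opp (τ : Triangle) : τ.opp.final = τ.first := by cases τ <;> rfl

theorem oppRibbon_append (ρ ρ' : List Triangle) :
    oppRibbon (ρ ++ ρ') = oppRibbon ρ' ++ oppRibbon ρ := by simp [oppRibbon]

theorem oppRibbon_oppRibbon (ρ : List Triangle) : oppRibbon (oppRibbon ρ) = ρ := by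
  simp [oppRibbon, Function.comp_def, Triangle.opp_opp]

theorem map_edge_oppRibbon (ρ : List Triangle) :
    (oppRibbon ρ).map Triangle.edge = (ρ.map Triangle.edge).reverse := by
  simp [oppRibbon, Function.comp_def, Triangle.edge_opp]

theorem forall_mem_oppRibbon_edge {p : Edge → Prop} {ρ : List Triangle} :
    (∀ τ ∈ oppRibbon ρ, p τ.edge) ↔ ∀ τ ∈ ρ, p τ.edge := by
  simp [oppRibbon, Triangle.edge_opp]

theorem IsRibbon.oppRibbon {ρ : List Triangle} (h : IsRibbon ρ) : IsRibbon (oppRibbon ρ) := by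
  refine ⟨?_, ?_⟩
  · rw [_root_.oppRibbon, List.isChain_reverse, List.isChain_map]
    refine h.1.imp fun τ τ' hτ => ?_
    rw [Triangle.final_opp, Triangle.first_opp, hτ]
  · rw [map_edge_oppRibbon, List.nodup_reverse]
    exact h.2

theorem RibbonIn.oppRibbon {ρ : List Triangle} {S : Set Plane} (h : RibbonIn ρ S) :
    RibbonIn (oppRibbon ρ) S :=
  forall_mem_oppRibbon_edge.2 h

theorem oppRibbon_intertwiningRibbon (ρ ρ' : HalfInfiniteRibbon) (ξ : ℕ → List Triangle) (m : ℕ) :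
    oppRibbon (intertwiningRibbon ρ ρ' ξ m) =
      intertwiningRibbon ρ' ρ (fun m => oppRibbon (ξ m)) m := by
  simp only [intertwiningRibbon, oppRibbon_append, oppRibbon_oppRibbon, List.append_assoc]

theorem IsBridge.symm {ρ ρ' : HalfInfiniteRibbon} {ξ : ℕ → List Triangle} (h : IsBridge ρ ρ' ξ) :
    IsBridge ρ' ρ fun m => oppRibbon (ξ m) where
  ribbon m hm := (h.ribbon m hm).oppRibbon
  concat m hm := by
    rw [← oppRibbon_intertwiningRibbon]
    exact (h.concat m hm).oppRibbon
  escapes x r := (h.escapes x r).mono fun _ hm => hm.oppRibbon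

section MiddleRibbon

variable {ρ ρ' : HalfInfiniteRibbon} {ξ : ℕ → List Triangle} {K N m : ℕ} {Λ : Set Plane}

variable (ρ ρ' ξ K m) in
/-- The part of the intertwining ribbon `σ_m` that is left when the first `K` triangles of `ρ` and
of `ρ'` are removed. -/
def middleRibbon : List Triangle := ρ.segment K m ++ ξ m ++ oppRibbon (ρ'.segment K m)

theorem intertwiningRibbon_eq_middleRibbon :
    intertwiningRibbon ρ ρ' ξ m = middleRibbon ρ ρ' ξ 0 m := by
  rw [intertwiningRibbon, middleRibbon, ρ.segment_zero, ρ'.segment_zero]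

theorem middleRibbon_eq_append (h : K ≤ N) (h' : N ≤ m) :
    middleRibbon ρ ρ' ξ K m =
      ρ.segment K N ++ middleRibbon ρ ρ' ξ N m ++ oppRibbon (ρ'.segment K N) := by
  simp only [middleRibbon, ← ρ.segment_append h h', ← ρ'.segment_append h h', oppRibbon_append,
    List.append_assoc]

theorem middleRibbon_infix_intertwiningRibbon (h : K ≤ m) :
    middleRibbon ρ ρ' ξ K m <:+: intertwiningRibbon ρ ρ' ξ m :=
  ⟨_, _, by rw [intertwiningRibbon_eq_middleRibbon, middleRibbon_eq_append K.zero_le h]⟩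

theorem RibbonIn.middleRibbon (h : RibbonIn (intertwiningRibbon ρ ρ' ξ m) Λ) (hK : K ≤ m) :
    RibbonIn (middleRibbon ρ ρ' ξ K m) Λ := fun τ hτ =>
  h τ ((middleRibbon_infix_intertwiningRibbon hK).subset hτ)

theorem IsBridge.isRibbon_middleRibbon (hξ : IsBridge ρ ρ' ξ) (h : K < m) :
    IsRibbon (middleRibbon ρ ρ' ξ K m) := by
  have hinfix := middleRibbon_infix_intertwiningRibbon (ρ := ρ) (ρ' := ρ') (ξ := ξ) h.le
  have hσ := hξ.concat m (Nat.one_le_of_lt h)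
  exact ⟨hσ.1.infix hinfix, hσ.2.sublist (hinfix.sublist.map _)⟩

theorem IsBridge.isPath_middleRibbon (hξ : IsBridge ρ ρ' ξ) (h : K < m) :
    IsPath (ρ.tri K).first (middleRibbon ρ ρ' ξ K m) (ρ'.tri K).first := by
  have hsegment (σ : HalfInfiniteRibbon) : σ.segment K (K + 1) = [σ.tri K] := by
    simp [HalfInfiniteRibbon.segment]
  have hends : middleRibbon ρ ρ' ξ K m =
      ρ.tri K :: (middleRibbon ρ ρ' ξ (K + 1) m ++ [(ρ'.tri K).opp]) := by
    rw [middleRibbon_eq_append K.le_succ h, hsegment, hsegment, oppRibbon_cons]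
    simp [oppRibbon]
  have hchain := (hξ.isRibbon_middleRibbon h).1
  rw [hends] at hchain ⊢
  exact (ρ'.tri K).final_opp ▸ isPath_of_isChain hchain

theorem IsBridge.eventually_edge_notMem (hξ : IsBridge ρ ρ' ξ) {E : Set Edge} (hE : E.Finite) :
    ∀ᶠ m in atTop, ∀ τ ∈ ξ m, τ.edge ∉ E := by
  obtain ⟨r, hr⟩ := (hE.image Edge.mid).isBounded.subset_ball (0 : Plane)
  filter_upwards [hξ.escapes 0 r] with m hm τ hτ hmem
  exact hm τ hτ (hr (Set.mem_image_of_mem _ hmem))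

theorem IsBridge.eventually_middleRibbon_edge_notMem (hξ : IsBridge ρ ρ' ξ) {E : Set Edge}
    (hE : E.Finite) : ∀ᶠ K in atTop, ∀ m ≥ K, ∀ τ ∈ middleRibbon ρ ρ' ξ K m, τ.edge ∉ E := by
  filter_upwards [ρ.eventually_segment_edge_notMem hE, ρ'.eventually_segment_edge_notMem hE,
    eventually_forall_ge_atTop.2 (hξ.eventually_edge_notMem hE)] with K hρ hρ' hξ m hm
  rw [middleRibbon, List.forall_mem_append, List.forall_mem_append]
  exact ⟨⟨hρ m, hξ m hm⟩, forall_mem_oppRibbon_edge (p := (· ∉ E)).2 (hρ' m)⟩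

/-- Late middle ribbons form a loop that crosses only edges of the cone that are far away, so
nothing keeps this loop from being contracted inside the cone. -/
theorem IsBridge.eventually_exists_isWinding (hξ : IsBridge ρ ρ' ξ) (hΛ : IsCone Λ)
    (hσΛ : ∀ m, 1 ≤ m → RibbonIn (intertwiningRibbon ρ ρ' ξ m) Λ) (K : ℕ) :
    ∀ᶠ N in atTop, ∀ m ≥ N, ∃ w,
      IsWinding (crossings (middleRibbon ρ ρ' ξ K m) - crossings (middleRibbon ρ ρ' ξ K N)) w ∧
        w (ρ.tri K).first.vertex = 0 ∧ w (ρ'.tri K).first.vertex = 0 := by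
  obtain ⟨a, ha⟩ := hΛ.eq_zero_of_jumps
  obtain ⟨R, hR⟩ := ha (ρ.tri K).first.vertex
  obtain ⟨R', hR'⟩ := ha (ρ'.tri K).first.vertex
  filter_upwards [eventually_gt_atTop K, hξ.eventually_middleRibbon_edge_notMem
    (edgesIn_ball_finite a (max R R'))] with N hKN hfar m hm
  obtain ⟨w, hw⟩ := exists_isWinding (n := crossings (middleRibbon ρ ρ' ξ K m) -
      crossings (middleRibbon ρ ρ' ξ K N)) fun f => by
    rw [map_sub, influx_crossings f (hξ.isPath_middleRibbon (hKN.trans_le hm)),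
      influx_crossings f (hξ.isPath_middleRibbon hKN), sub_self]
  have hzero : ∀ k ≥ N, ∀ e : Edge, ¬ (e.mid ∈ Λ ∧ e.mid ∉ Metric.ball a (max R R')) →
      crossings (middleRibbon ρ ρ' ξ N k) e = 0 := fun k hk e he =>
    crossings_apply_eq_zero fun τ hτ h => he (h ▸
      ⟨(hσΛ k (Nat.one_le_of_lt (hKN.trans_le hk))).middleRibbon hk τ hτ, hfar k hk τ hτ⟩)
  have hjump : ∀ e : Edge, w e.source ≠ w e.target →
      e.mid ∈ Λ ∧ e.mid ∉ Metric.ball a (max R R') := by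
    refine fun e => not_imp_comm.1 fun he => sub_eq_zero.1 ((hw e).trans ?_)
    rw [middleRibbon_eq_append hKN.le hm, middleRibbon_eq_append hKN.le le_rfl]
    simp [crossings_append, hzero m hm e he, hzero N le_rfl e he]
  have hball {r : ℝ} (hr : r ≤ max R R') (e : Edge) (he : w e.source ≠ w e.target) :
      e.mid ∈ Λ ∧ e.mid ∉ Metric.ball a r :=
    (hjump e he).imp_right (mt fun h => Metric.ball_subset_ball hr h)
  exact ⟨w, hw, hR w (hball (le_max_left R R')), hR' w (hball (le_max_right R R'))⟩

end MiddleRibbon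

section Multiplets

variable {G : Type*} [Group G] [Fintype G] [DecidableEq G] {n : ℕ}
  (D : QuantumDouble G →⋆ₐ[ℂ] Matrix (Fin n) (Fin n) ℂ)

theorem ribbonMultiplet_append_append_mul {ρ σ κ : List Triangle} {O : quasiLocal G}
    (hnodup : ((ρ ++ σ ++ κ).map Triangle.edge).Nodup)
    (hO : ∀ τ ∈ σ, ∀ g h, Commute O (matUnit τ.edge g h)) (i j : Fin n) :
    ribbonMultiplet D (ρ ++ σ ++ κ) i j * O = ∑ q, ∑ p,
      ribbonMultiplet D ρ i p * (ribbonMultiplet D κ q j * O) * ribbonMultiplet D σ p q := by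
  have hκ (q : Fin n) (τ : Triangle) (hτ : τ ∈ σ) (g h : G) :
      Commute (ribbonMultiplet D κ q j) (matUnit τ.edge g h) := by
    refine (commute_ribbonMultiplet D (fun τ' hτ' g' h' => commute_matUnit ?_ g h g' h') q j).symm
    rw [List.map_append, List.nodup_append] at hnodup
    exact hnodup.2.2 _ (List.mem_map_of_mem (List.mem_append_right ρ hτ)) _
      (List.mem_map_of_mem hτ')
  have hcomm (p q : Fin n) :
      Commute (ribbonMultiplet D κ q j * O) (ribbonMultiplet D σ p q) :=
    (commute_ribbonMultiplet D (hκ q) p q).mul_left (commute_ribbonMultiplet D hO p q)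
  simp only [ribbonMultiplet_append, Matrix.mul_apply, Finset.sum_mul]
  refine Finset.sum_congr rfl fun q _ => Finset.sum_congr rfl fun p _ => ?_
  rw [mul_assoc, mul_assoc, ← (hcomm p q).eq, ← mul_assoc]

theorem ribbonMultiplet_oppRibbon_mul_finiteAmpli {ρ ξ ρ' : List Triangle} {O : quasiLocal G}
    (hO : ∀ τ ∈ ξ, ∀ g h, Commute O (matUnit τ.edge g h)) :
    ribbonMultiplet D (oppRibbon (ρ ++ ξ ++ oppRibbon ρ')) * finiteAmpli D ρ O =
      finiteAmpli D ρ' O * ribbonMultiplet D (oppRibbon (ρ ++ ξ ++ oppRibbon ρ')) := by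
  have hξ := (commute_diagonal_ribbonMultiplet D (ρ := oppRibbon ξ)
    (forall_mem_oppRibbon_edge (p := fun e => ∀ g h, Commute O (matUnit e g h)).2 hO)).eq
  have hρ : (ribbonMultiplet D ρ)ᴴ * ribbonMultiplet D ρ = 1 := (ribbonMultiplet_mem_unitary D ρ).1
  have hρ' : (ribbonMultiplet D ρ')ᴴ * ribbonMultiplet D ρ' = 1 :=
    (ribbonMultiplet_mem_unitary D ρ').1
  simp only [oppRibbon_append, oppRibbon_oppRibbon, ribbonMultiplet_append, finiteAmpli,
    ribbonMultiplet_oppRibbon D ρ]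
  calc _ = ribbonMultiplet D ρ' * (ribbonMultiplet D (oppRibbon ξ) *
        (((ribbonMultiplet D ρ)ᴴ * ribbonMultiplet D ρ) * (Matrix.diagonal fun _ => O)) *
          (ribbonMultiplet D ρ)ᴴ) := by simp only [mul_assoc]
    _ = ribbonMultiplet D ρ' * ((Matrix.diagonal fun _ => O) *
        (((ribbonMultiplet D ρ')ᴴ * ribbonMultiplet D ρ') * ribbonMultiplet D (oppRibbon ξ)) *
          (ribbonMultiplet D ρ)ᴴ) := by rw [hρ, hρ', one_mul, one_mul, hξ]
    _ = _ := by simp only [mul_assoc]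

end Multiplets

/-! ## Strong limits -/

section StrongLimits

/-- By the uniform boundedness principle, evaluation is sequentially continuous jointly in the
operator and the vector. -/
theorem tendsto_clm_apply {𝕜 E F : Type*} [NontriviallyNormedField 𝕜] [NormedAddCommGroup E]
    [NormedSpace 𝕜 E] [CompleteSpace E] [NormedAddCommGroup F] [NormedSpace 𝕜 F]
    {T : ℕ → E →L[𝕜] F} {T' : E →L[𝕜] F} (hT : ∀ x, Tendsto (fun m => T m x) atTop (𝓝 (T' x)))
    {x : ℕ → E} {y : E} (hx : Tendsto x atTop (𝓝 y)) :
    Tendsto (fun m => T m (x m)) atTop (𝓝 (T' y)) := by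
  obtain ⟨C, hC⟩ := banach_steinhaus fun x =>
    (hT x).norm.bddAbove_range.imp fun _ h m => h (Set.mem_range_self m)
  have hsub : Tendsto (fun m => T m (x m - y)) atTop (𝓝 0) := by
    refine squeeze_zero_norm (fun m => (T m).le_of_opNorm_le (hC m) _) ?_
    simpa using (tendsto_iff_norm_sub_tendsto_zero.1 hx).const_mul C
  simpa using hsub.add (hT y)

variable {ι H : Type*} [NormedAddCommGroup H] [InnerProductSpace ℂ H]

/-- Entrywise convergence of matrices of operators in the strong operator topology. -/
def StronglyTendsto (T : ℕ → Matrix ι ι (H →L[ℂ] H)) (U : Matrix ι ι (H →L[ℂ] H)) : Prop :=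
  ∀ i j (ψ : H), Tendsto (fun m => T m i j ψ) atTop (𝓝 (U i j ψ))

namespace StronglyTendsto

variable {S T : ℕ → Matrix ι ι (H →L[ℂ] H)} {U V : Matrix ι ι (H →L[ℂ] H)}

theorem const (U : Matrix ι ι (H →L[ℂ] H)) : StronglyTendsto (fun _ => U) U :=
  fun _ _ _ => tendsto_const_nhds

theorem unique (hU : StronglyTendsto T U) (hV : StronglyTendsto T V) : U = V :=
  Matrix.ext fun i j => ContinuousLinearMap.ext fun ψ => tendsto_nhds_unique (hU i j ψ) (hV i j ψ)

theorem congr' (hU : StronglyTendsto S U) (h : ∀ᶠ m in atTop, S m = T m) : StronglyTendsto T U :=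
  fun i j ψ => (hU i j ψ).congr' (h.mono fun _ hm => hm ▸ rfl)

theorem mem_centralizer {C : Set (H →L[ℂ] H)} (hU : StronglyTendsto T U)
    (hT : ∀ᶠ m in atTop, ∀ i j, T m i j ∈ Set.centralizer C) (i j : ι) :
    U i j ∈ Set.centralizer C := by
  refine Set.mem_centralizer_iff.2 fun A hA => ContinuousLinearMap.ext fun ψ => ?_
  refine tendsto_nhds_unique ((A.continuous.tendsto _).comp (hU i j ψ))
    ((hU i j (A ψ)).congr' (hT.mono fun m hm => ?_))
  exact congrArg (· ψ) (Set.mem_centralizer_iff.1 (hm i j) A hA).symm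

variable [CompleteSpace H]

theorem conjTranspose_eq (hU : StronglyTendsto T U) (hV : StronglyTendsto (fun m => (T m)ᴴ) V) :
    Uᴴ = V := by
  ext i j : 1
  rw [Matrix.conjTranspose_apply, ContinuousLinearMap.star_eq_adjoint, eq_comm,
    ContinuousLinearMap.eq_adjoint_iff]
  intro x y
  refine tendsto_nhds_unique ((hV i j x).inner tendsto_const_nhds)
    ((tendsto_const_nhds.inner (hU j i y)).congr fun m => ?_)
  change ⟪x, T m j i y⟫_ℂ = ⟪(T m j i).adjoint x, y⟫_ℂ
  rw [ContinuousLinearMap.adjoint_inner_left]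

variable [Fintype ι]

theorem mul (hU : StronglyTendsto S U) (hV : StronglyTendsto T V) :
    StronglyTendsto (fun m => S m * T m) (U * V) := fun i j ψ => by
  simp only [Matrix.mul_apply, sum_apply, mul_apply_eq_comp]
  exact tendsto_finsetSum _ fun k _ => tendsto_clm_apply (hU i k) (hV k j ψ)

theorem mem_unitary [DecidableEq ι] (hT : ∀ m, T m ∈ unitary (Matrix ι ι (H →L[ℂ] H)))
    (hU : StronglyTendsto T U) (hU' : StronglyTendsto (fun m => (T m)ᴴ) Uᴴ) :
    U ∈ unitary (Matrix ι ι (H →L[ℂ] H)) :=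
  ⟨(hU'.mul hU).unique ((const 1).congr' (.of_forall fun m => (hT m).1.symm)),
    (hU.mul hU').unique ((const 1).congr' (.of_forall fun m => (hT m).2.symm))⟩

end StronglyTendsto

theorem exists_stronglyTendsto_of_dense [CompleteSpace H] {T : ℕ → Matrix ι ι (H →L[ℂ] H)}
    (hT : ∀ m i j, ‖T m i j‖ ≤ 1) {S : Set H} (hS : Dense S)
    (h : ∀ i j, ∀ ψ ∈ S, CauchySeq fun m => T m i j ψ) : ∃ U, StronglyTendsto T U := by
  have hequi (i j : ι) : Equicontinuous fun m => (T m i j : H → H) :=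
    (LipschitzWith.uniformEquicontinuous _ 1 fun m =>
      (T m i j).lipschitz.weaken (hT m i j)).equicontinuous
  choose L hL using fun i j ψ => cauchySeq_tendsto_of_complete
    (cauchySeq_of_dense (hequi i j) hS (h i j) ψ)
  exact ⟨Matrix.of fun i j => continuousLinearMapOfTendsto (fun m => T m i j)
    (tendsto_pi_nhds.2 (hL i j)), hL⟩

end StrongLimits

section Intertwiner

variable {G : Type*} [Group G] [Fintype G] [DecidableEq G]
  {ω₀ : quasiLocal G →ₗ[ℂ] ℂ} {H : Type*} [NormedAddCommGroup H] [InnerProductSpace ℂ H]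
  [CompleteSpace H] {π₀ : quasiLocal G →⋆ₐ[ℂ] (H →L[ℂ] H)} {Ω : H} {Λ : Set Plane}
  {ρ ρ' : HalfInfiniteRibbon} {ξ : ℕ → List Triangle} {n : ℕ}
  (D : QuantumDouble G →⋆ₐ[ℂ] Matrix (Fin n) (Fin n) ℂ)

theorem middleMultiplet_eventually_const (hω₀ : IsFrustrationFreeGroundState ω₀)
    (hGNS : IsGNSTriple ω₀ π₀ Ω) (hΛ : IsCone Λ) (hξ : IsBridge ρ ρ' ξ)
    (hσΛ : ∀ m, 1 ≤ m → RibbonIn (intertwiningRibbon ρ ρ' ξ m) Λ) (K : ℕ) :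
    ∀ᶠ N in atTop, ∀ m ≥ N, ∀ p q,
      π₀ (ribbonMultiplet D (middleRibbon ρ ρ' ξ K m) p q) Ω =
        π₀ (ribbonMultiplet D (middleRibbon ρ ρ' ξ K N) p q) Ω := by
  filter_upwards [eventually_gt_atTop K, hξ.eventually_exists_isWinding hΛ hσΛ K]
    with N hKN hN m hm p q
  obtain ⟨w, hw, hs, hs'⟩ := hN m hm
  have hKm : K < m := hKN.trans_le hm
  have hop := hw.ribbonOp_apply_ground_vector_eq hω₀ hGNS (hξ.isPath_middleRibbon hKm)
    (hξ.isPath_middleRibbon hKN) (hξ.isRibbon_middleRibbon hKm).2 (hξ.isRibbon_middleRibbon hKN).2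
    hs hs'
  simp only [ribbonMultiplet, Matrix.of_apply, map_sum, map_smul, sum_apply, smul_apply, hop]

theorem intertwiningMultiplet_eventually_const (hω₀ : IsFrustrationFreeGroundState ω₀)
    (hGNS : IsGNSTriple ω₀ π₀ Ω) (hΛ : IsCone Λ) (hξ : IsBridge ρ ρ' ξ)
    (hσΛ : ∀ m, 1 ≤ m → RibbonIn (intertwiningRibbon ρ ρ' ξ m) Λ) {O : quasiLocal G}
    (hO : O ∈ localObs G) (i j : Fin n) :
    ∃ φ, ∀ᶠ m in atTop,
      π₀ (ribbonMultiplet D (intertwiningRibbon ρ ρ' ξ m) i j) (π₀ O Ω) = φ := by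
  obtain ⟨E, hE, hcomm⟩ := hO
  obtain ⟨K, hK⟩ := (hξ.eventually_middleRibbon_edge_notMem hE).exists
  obtain ⟨N, hN, hKN⟩ := ((middleMultiplet_eventually_const D hω₀ hGNS hΛ hξ hσΛ K).and
    (eventually_gt_atTop K)).exists
  refine ⟨∑ q, ∑ p, π₀ (ribbonMultiplet D (ρ.initial K) i p *
    (ribbonMultiplet D (oppRibbon (ρ'.initial K)) q j * O))
      (π₀ (ribbonMultiplet D (middleRibbon ρ ρ' ξ K N) p q) Ω), ?_⟩
  filter_upwards [eventually_ge_atTop N] with m hm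
  have hKm : K < m := hKN.trans_le hm
  have hnodup := (hξ.concat m (Nat.one_le_of_lt hKm)).2
  rw [intertwiningRibbon_eq_middleRibbon, middleRibbon_eq_append K.zero_le hKm.le,
    ρ.segment_zero, ρ'.segment_zero] at hnodup ⊢
  rw [← mul_apply_eq_comp, ← map_mul, ribbonMultiplet_append_append_mul D hnodup
    fun τ hτ => hcomm _ (hK m hKm.le τ hτ)]
  simp only [map_sum, sum_apply, map_mul, mul_apply_eq_comp, hN m hm]

theorem exists_stronglyTendsto_intertwiningMultiplet (hω₀ : IsFrustrationFreeGroundState ω₀)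
    (hGNS : IsGNSTriple ω₀ π₀ Ω) (hΛ : IsCone Λ) (hξ : IsBridge ρ ρ' ξ)
    (hσΛ : ∀ m, 1 ≤ m → RibbonIn (intertwiningRibbon ρ ρ' ξ m) Λ) :
    ∃ U, StronglyTendsto
      (fun m => (ribbonMultiplet D (intertwiningRibbon ρ ρ' ξ m)).map π₀) U := by
  have hdense : Dense ((fun a => π₀ a Ω) '' (localObs G : Set (quasiLocal G))) :=
    DenseRange.dense_image hGNS.cyclic ((continuous_rep π₀).clm_apply continuous_const)
      dense_localObs
  refine exists_stronglyTendsto_of_dense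
    (fun m i j => (norm_rep_le π₀ _).trans (norm_ribbonMultiplet_le D _ i j)) hdense ?_
  rintro i j _ ⟨O, hO, rfl⟩
  obtain ⟨φ, hφ⟩ := intertwiningMultiplet_eventually_const D hω₀ hGNS hΛ hξ hσΛ hO i j
  exact (tendsto_nhds_of_eventually_eq hφ).cauchySeq

theorem exists_stronglyTendsto_oppMultiplet (hω₀ : IsFrustrationFreeGroundState ω₀)
    (hGNS : IsGNSTriple ω₀ π₀ Ω) (hΛ : IsCone Λ) (hξ : IsBridge ρ ρ' ξ)
    (hσΛ : ∀ m, 1 ≤ m → RibbonIn (intertwiningRibbon ρ ρ' ξ m) Λ) :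
    ∃ U, StronglyTendsto
        (fun m => (ribbonMultiplet D (oppRibbon (intertwiningRibbon ρ ρ' ξ m))).map π₀) U ∧
      StronglyTendsto
        (fun m => ((ribbonMultiplet D (oppRibbon (intertwiningRibbon ρ ρ' ξ m))).map π₀)ᴴ) Uᴴ := by
  obtain ⟨V, hV⟩ := exists_stronglyTendsto_intertwiningMultiplet D hω₀ hGNS hΛ hξ hσΛ
  obtain ⟨U, hU⟩ := exists_stronglyTendsto_intertwiningMultiplet D hω₀ hGNS hΛ hξ.symm
    fun m hm => oppRibbon_intertwiningRibbon ρ ρ' ξ m ▸ (hσΛ m hm).oppRibbon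
  simp only [← oppRibbon_intertwiningRibbon] at hU
  have hadjoint (m : ℕ) : (ribbonMultiplet D (intertwiningRibbon ρ ρ' ξ m)).map π₀ =
      ((ribbonMultiplet D (oppRibbon (intertwiningRibbon ρ ρ' ξ m))).map π₀)ᴴ := by
    rw [← Matrix.conjTranspose_map _ (map_star π₀), ← ribbonMultiplet_oppRibbon,
      oppRibbon_oppRibbon]
  simp only [hadjoint] at hV
  exact ⟨U, hU, (hU.conjTranspose_eq hV).symm ▸ hV⟩

variable {U : Matrix (Fin n) (Fin n) (H →L[ℂ] H)}

theorem ampli_map_mul_eq_of_stronglyTendsto (hξ : IsBridge ρ ρ' ξ)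
    (hU : StronglyTendsto
      (fun m => (ribbonMultiplet D (oppRibbon (intertwiningRibbon ρ ρ' ξ m))).map π₀) U)
    (O : quasiLocal G) : (ampli D ρ' O).map π₀ * U = U * (ampli D ρ O).map π₀ := by
  have hcont (σ : HalfInfiniteRibbon) : Continuous fun O => (ampli D σ O).map π₀ :=
    continuous_matrix fun i j => (continuous_rep π₀).comp (continuous_ampli_apply D σ i j)
  refine congrFun (((hcont ρ').mul continuous_const).ext_on dense_localObs
    (continuous_const.mul (hcont ρ)) fun O hO => ?_) O
  refine ((StronglyTendsto.const _).mul hU).unique ((hU.mul (.const _)).congr' ?_)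
  have hampli := finiteAmpli_eventuallyEq_ampli D ρ hO
  have hampli' := finiteAmpli_eventuallyEq_ampli D ρ' hO
  obtain ⟨E, hE, hcomm⟩ := hO
  filter_upwards [hampli, hampli', hξ.eventually_edge_notMem hE] with m hm hm' hfar
  simp only [← Matrix.map_mul]
  rw [← hm, ← hm', intertwiningRibbon,
    ribbonMultiplet_oppRibbon_mul_finiteAmpli D fun τ hτ => hcomm _ (hfar τ hτ)]

theorem map_ribbonMultiplet_mem_unitary (ρ : List Triangle) :
    (ribbonMultiplet D ρ).map π₀ ∈ unitary (Matrix (Fin n) (Fin n) (H →L[ℂ] H)) := by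
  obtain ⟨hleft, hright⟩ := ribbonMultiplet_mem_unitary D ρ
  rw [Matrix.star_eq_conjTranspose] at hleft hright
  rw [Unitary.mem_iff, Matrix.star_eq_conjTranspose, ← Matrix.conjTranspose_map _ (map_star π₀),
    ← Matrix.map_mul, ← Matrix.map_mul, hleft, hright, Matrix.map_one _ (map_zero _) (map_one _)]
  exact ⟨rfl, rfl⟩

end Intertwiner

theorem lemma5p5_general {G : Type*} [Group G] [Fintype G] [DecidableEq G]
    {ω₀ : quasiLocal G →ₗ[ℂ] ℂ} (hω₀ : IsFrustrationFreeGroundState ω₀)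
    {H : Type*} [NormedAddCommGroup H] [InnerProductSpace ℂ H] [CompleteSpace H]
    {π₀ : quasiLocal G →⋆ₐ[ℂ] (H →L[ℂ] H)} {Ω : H} (hGNS : IsGNSTriple ω₀ π₀ Ω)
    {Λ C : Set Plane} (hC : IsCone C) (hΛC : Λ ⊆ C)
    {ρ ρ' : HalfInfiniteRibbon} {ξ : ℕ → List Triangle} (hξ : IsBridge ρ ρ' ξ)
    (hσΛ : ∀ m, 1 ≤ m → RibbonIn (intertwiningRibbon ρ ρ' ξ m) Λ)
    {n : ℕ} (D : QuantumDouble G →⋆ₐ[ℂ] Matrix (Fin n) (Fin n) ℂ) :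
    (∀ O, Tendsto (fun m => finiteAmpli D (ρ.initial m) O) atTop (𝓝 (ampli D ρ O))) ∧
    (∀ O, Tendsto (fun m => finiteAmpli D (ρ'.initial m) O) atTop (𝓝 (ampli D ρ' O))) ∧
    ∃ U : Matrix (Fin n) (Fin n) (H →L[ℂ] H),
      U ∈ unitary (Matrix (Fin n) (Fin n) (H →L[ℂ] H)) ∧
      (∀ i j, U i j ∈ coneAlgebra π₀ Λ) ∧
      (∀ O, (ampli D ρ' O).map π₀ = U * (ampli D ρ O).map π₀ * Uᴴ) ∧
      (∀ i j (ψ : H),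
        Tendsto (fun m =>
          π₀ (ribbonMultiplet D (oppRibbon (intertwiningRibbon ρ ρ' ξ m)) i j) ψ)
          atTop (𝓝 (U i j ψ)) ∧
        Tendsto (fun m =>
          star (π₀ (ribbonMultiplet D (oppRibbon (intertwiningRibbon ρ ρ' ξ m)) i j)) ψ)
          atTop (𝓝 (star (U i j) ψ))) := by
  obtain ⟨U, hU, hU'⟩ := exists_stronglyTendsto_oppMultiplet D hω₀ hGNS hC hξ
    fun m hm τ hτ => hΛC (hσΛ m hm τ hτ)
  have hunitary := hU.mem_unitary (fun m => map_ribbonMultiplet_mem_unitary D _) hU'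
  refine ⟨tendsto_finiteAmpli D ρ, tendsto_finiteAmpli D ρ', U, hunitary,
    hU.mem_centralizer ?_, fun O => ?_, fun i j ψ => ⟨hU i j ψ, hU' j i ψ⟩⟩
  · filter_upwards [eventually_ge_atTop 1] with m hm i j
    exact Set.subset_centralizer_centralizer (Set.mem_image_of_mem π₀
      (ribbonMultiplet_mem_localAlgebra D (hσΛ m hm).oppRibbon i j))
  · have hUU : U * Uᴴ = 1 := hunitary.2
    rw [← ampli_map_mul_eq_of_stronglyTendsto D hξ hU, mul_assoc, hUU, mul_one]

theorem lemma5p5 {G : Type*} [Group G] [Fintype G] [DecidableEq G]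
    (ω₀ : quasiLocal G →ₗ[ℂ] ℂ) (hω₀ : IsFrustrationFreeGroundState ω₀)
    {H : Type*} [NormedAddCommGroup H] [InnerProductSpace ℂ H] [CompleteSpace H]
    (π₀ : quasiLocal G →⋆ₐ[ℂ] (H →L[ℂ] H)) (Ω : H) (hGNS : IsGNSTriple ω₀ π₀ Ω)
    (Λ : Set Plane) (hΛ : IsCone Λ)
    (ρ ρ' : HalfInfiniteRibbon) (hρ : ρ.IsPositive) (hρ' : ρ'.IsNegative)
    (hρΛ : ρ.SupportedIn Λ) (hρ'Λ : ρ'.SupportedIn Λ)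
    (ξ : ℕ → List Triangle) (hξ : IsBridge ρ ρ' ξ)
    (hσΛ : ∀ m, 1 ≤ m → RibbonIn (intertwiningRibbon ρ ρ' ξ m) Λ)
    (n : ℕ) (D : QuantumDouble G →⋆ₐ[ℂ] Matrix (Fin n) (Fin n) ℂ) :
    -- the limits defining the two amplimorphisms exist
    (∀ O, Tendsto (fun m => finiteAmpli D (ρ.initial m) O) atTop (𝓝 (ampli D ρ O))) ∧
    (∀ O, Tendsto (fun m => finiteAmpli D (ρ'.initial m) O) atTop (𝓝 (ampli D ρ' O))) ∧
    ∃ U : Matrix (Fin n) (Fin n) (H →L[ℂ] H),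
      U ∈ unitary (Matrix (Fin n) (Fin n) (H →L[ℂ] H)) ∧
      (∀ i j, U i j ∈ coneAlgebra π₀ Λ) ∧
      (∀ O, (ampli D ρ' O).map π₀ = U * (ampli D ρ O).map π₀ * Uᴴ) ∧
      -- `U` is the strong-* limit of the multiplets of the opposite intertwining ribbons
      (∀ i j (ψ : H),
        Tendsto (fun m =>
          π₀ (ribbonMultiplet D (oppRibbon (intertwiningRibbon ρ ρ' ξ m)) i j) ψ)
          atTop (𝓝 (U i j ψ)) ∧
        Tendsto (fun m =>
          star (π₀ (ribbonMultiplet D (oppRibbon (intertwiningRibbon ρ ρ' ξ m)) i j)) ψ)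
          atTop (𝓝 (star (U i j) ψ))) :=
  lemma5p5_general hω₀ hGNS hΛ subset_rfl hξ hσΛ D
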